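/- **Setting.** Hilbert spaces are complex; inner products are linear in the second argument; $\otimes$ is the Hilbert space tensor product and, for subspaces, $U_1\underline{\otimes}U_2$ is the linear span of $\{u_1\otimes u_2\}$ in it. Let $\mathsf M$ be a von Neumann algebra on $\mathsf H$ with commutant $\mathsf M'$ and a cyclic and separating vector $\xi$. Put $\Xi=\mathsf M'\xi$, and let $S_\xi$ be the Tomita–Takesaki operator, the closure of $x\xi\mapsto x^*\xi$ ($x\in\mathsf M$). Let $\mathsf k,\mathsf k_1,\mathsf k_2$ be Hilbert spaces with conjugations (conjugate-linear isometric involutions) $k,k_1,k_2$, written $c\mapsto\bar c$; $\mathbb C$ carries complex conjugation. $k\otimes S_\xi$ is the closure of the operator $c\otimes v\mapsto kc\otimes S_\xi v$ with domain $\mathsf k\,\underline\otimes\,\mathrm{Dom}\,S_\xi$. $HS(\cdot;\cdot)$ denotes Hilbert–Schmidt operators. $\mathbb C\otimes\mathsf H$ is identified with $\mathsf H$. For Hilbert spaces $\mathsf h_1,\mathsf h_2$: * $\mathcal O_{\mathsf M}(\mathsf h_1\underline\otimes\Xi;\mathsf h_2\otimes\mathsf H)$ is the space of linear operators $T$ with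 domain $\mathsf h_1\underline\otimes\Xi$ and values in $\mathsf h_2\otimes\mathsf H$ which are affiliated: $(I\otimes u^*)T(I\otimes u)=T$, domains included, for all unitaries $u\in\mathsf M'$. For such $T$, $TE_\xi:\mathsf h_1\to\mathsf h_2\otimes\mathsf H$ is $c\mapsto T(c\otimes\xi)$. * $\mathcal O^\ddagger_{\mathsf M}(\mathsf h_1\underline\otimes\Xi,\mathsf h_2\underline\otimes\Xi)$ is the set of those $T$ for which $\mathrm{Dom}\,T^*\supset\mathsf h_2\underline\otimes\Xi$; then $T^\dagger:=T^*|_{\mathsf h_2\underline\otimes\Xi}$. Write $\mathcal O_{\mathsf M}^\ddagger(\Xi)$ for the case $\mathsf h_1=\mathsf h_2=\mathbb C$. * For a linear $B:\mathsf h_1\to\mathsf h_2\otimes\mathsf H$, $B^\xi$ is the operator with domain $\mathsf h_1\underline\otimes\Xi$ determined by $B^\xi(c\otimes x'\xi)=(I\otimes x')Bc$ ($x'\in\mathsf M'$). * $HS^\ddagger_{\mathsf M,\xi}(\mathsf h_1;\mathsf h_2\otimes\mathsf H)$ is the set of $B\in HS(\mathsf h_1;\mathsf h_2\otimes\mathsf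 H)$ for which there is a $B_\dagger\in HS(\mathsf h_2;\mathsf h_1\otimes\mathsf H)$ with $B^*(I\otimes x')E_\xi=E_\xi^*(I\otimes x')B_\dagger$ for all $x'\in\mathsf M'$, where $E_\xi c=c\otimes\xi$. * For $B\in HS(\mathsf k_1;\mathsf k_2\otimes\mathsf H)$, $B_{\mathsf T}:\mathsf k_2\to\mathsf k_1\otimes\mathsf H$ is the bounded operator determined by $\langle c_1\otimes v,B_{\mathsf T}c_2\rangle=\langle\bar c_2\otimes v,B\bar c_1\rangle$. For $A\in B(\mathsf k_1;\mathsf k_2)$, $\bar A=k_2Ak_1$ and $A^{\mathsf t}=\bar A^*$. * $\mathsf M_{\mathsf h_1;\mathsf h_2}(\mathsf M,\xi)$ is the set of $T\in\mathcal O_{\mathsf M}(\mathsf h_1\underline\otimes\Xi;\mathsf h_2\otimes\mathsf H)$ with $TE_\xi$ Hilbert–Schmidt; for $T\in\mathsf M_{\mathsf k_1;\mathsf k_2}(\mathsf M,\xi)$, $T^{\mathsf T}:=((TE_\xi)_{\mathsf T})^\xi$. * $\mathsf M^\dagger_{\mathsf h_1;\mathsf h_2}(\mathsf M,\xi)$,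 the adjointable matrix space, is the set of $T\in\mathsf M_{\mathsf h_1;\mathsf h_2}(\mathsf M,\xi)\cap\mathcal O^\ddagger_{\mathsf M}(\mathsf h_1\underline\otimes\Xi,\mathsf h_2\underline\otimes\Xi)$ with $T^\dagger\in\mathsf M_{\mathsf h_2;\mathsf h_1}(\mathsf M,\xi)$. Put $\mathsf C^\dagger_{\mathsf k}=\mathsf M^\dagger_{\mathbb C;\mathsf k}(\mathsf M,\xi)$ (columns) and $\mathsf R^\dagger_{\mathsf k}=\mathsf M^\dagger_{\mathsf k;\mathbb C}(\mathsf M,\xi)$ (rows). * For bounded $A$ and an operator $X$ with domain $\Xi$, $A\otimes X$ has domain $\mathsf k_1\underline\otimes\Xi$; $HS(\mathsf k_1;\mathsf k_2)\underline\otimes\mathcal O^\ddagger_{\mathsf M}(\Xi)$ is the linear span of the $A\otimes X$ with $A\in HS(\mathsf k_1;\mathsf k_2)$, $X\in\mathcal O^\ddagger_{\mathsf M}(\Xi)$. **Theorem.** The following hold. 1. $\mathsf M^\dagger_{\mathsf k_1;\mathsf k_2}(\mathsf M,\xi)=\{B^\xi: B\in HS^\ddagger_{\mathsf M,\xi}(\mathsf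 k_1;\mathsf k_2\otimes\mathsf H)\}=\{T\in\mathcal O^\ddagger_{\mathsf M}(\mathsf k_1\underline\otimes\Xi,\mathsf k_2\underline\otimes\Xi): TE_\xi\in HS(\mathsf k_1;\mathsf k_2\otimes\mathsf H),\ T^\dagger E_\xi\in HS(\mathsf k_2;\mathsf k_1\otimes\mathsf H)\}$. 2. $HS(\mathsf k_1;\mathsf k_2)\underline\otimes\mathcal O^\ddagger_{\mathsf M}(\Xi)\subset\mathsf M^\dagger_{\mathsf k_1;\mathsf k_2}(\mathsf M,\xi)$, with equality if $\mathsf M=\mathbb C$ (scalar operators only), or if $\mathsf k_1=\mathsf k_2=\mathbb C$. 3. $(A\otimes X)^{\mathsf T\dagger}=A^{\mathsf t*}\otimes X^\dagger=\bar A\otimes X^\dagger$ for $A\in HS(\mathsf k_1;\mathsf k_2)$ and $X\in\mathcal O^\ddagger_{\mathsf M}(\Xi)$. 4. $\mathsf C^\dagger_{\mathsf k}=\{C\in\mathcal O^\ddagger_{\mathsf M}(\Xi,\mathsf k\underline\otimes\Xi): C^\dagger E_\xi\in HS(\mathsf k;\mathsf H)\}$ and $\mathsf R^\dagger_{\mathsf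 k}=\{R\in\mathcal O^\ddagger_{\mathsf M}(\mathsf k\underline\otimes\Xi,\Xi): RE_\xi\in HS(\mathsf k;\mathsf H)\}$. 5. $\mathsf C^\dagger_{\mathsf k}=\{|\zeta\rangle^\xi:\zeta\in\mathrm{Dom}(k\otimes S_\xi)\}=\{C\in\mathcal O_{\mathsf M}(\Xi;\mathsf k\otimes\mathsf H): C\xi\in\mathrm{Dom}(k\otimes S_\xi)\}$, where $|\zeta\rangle:\mathbb C\to\mathsf k\otimes\mathsf H$, $z\mapsto z\zeta$. 6. For all $T\in\mathsf M^\dagger_{\mathsf k_1;\mathsf k_2}(\mathsf M,\xi)$ and $C\in\mathsf C^\dagger_{\mathsf k}$: $T^\dagger,T^{\mathsf T}\in\mathsf M^\dagger_{\mathsf k_2;\mathsf k_1}(\mathsf M,\xi)$, $T^{\mathsf T\mathsf T}=T^{\dagger\dagger}=T$, $T^{\dagger\mathsf T}=T^{\mathsf T\dagger}$, $T^{\dagger\mathsf T}E_\xi=(k_2\otimes S_\xi)\,TE_\xi\,k_1$ (in particular $TE_\xi$ has range in $\mathrm{Dom}(k_2\otimes S_\xi)$), and $C^{\dagger\mathsf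 T}\xi=(k\otimes S_\xi)C\xi$. -/

import Mathlib

open scoped TensorProduct ComplexConjugate

noncomputable section

namespace AdjointableMatrix

/-! ### Hilbert space tensor products -/

section HilbertTensor

variable (K : Type*) [NormedAddCommGroup K] [InnerProductSpace ℂ K]
  (H : Type*) [NormedAddCommGroup H] [InnerProductSpace ℂ H]

/-- The Hilbert space tensor product `K ⊗ H`: the completion of the algebraic tensor product
for the inner product with `⟪c ⊗ v, c' ⊗ v'⟫ = ⟪c, c'⟫ ⟪v, v'⟫`. -/
abbrev HTensor : Type _ := UniformSpace.Completion (K ⊗[ℂ] H)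

variable {K H}

/-- The simple tensor `c ⊗ v` in the Hilbert space tensor product. -/
def htmul (c : K) (v : H) : HTensor K H := ((c ⊗ₜ[ℂ] v : K ⊗[ℂ] H) : HTensor K H)

theorem inner_htmul (c c' : K) (v v' : H) :
    inner ℂ (htmul c v) (htmul c' v') = inner ℂ c c' * inner ℂ v v' := by
  simp [htmul, UniformSpace.Completion.inner_coe]

theorem htmul_add_left (c c' : K) (v : H) : htmul (c + c') v = htmul c v + htmul c' v := by
  rw [htmul, TensorProduct.add_tmul, UniformSpace.Completion.coe_add]; rfl

theorem htmul_smul_left (a : ℂ) (c : K) (v : H) : htmul (a • c) v = a • htmul c v := by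
  rw [htmul, ← TensorProduct.smul_tmul', UniformSpace.Completion.coe_smul]; rfl

theorem htmul_add_right (c : K) (v v' : H) : htmul c (v + v') = htmul c v + htmul c v' := by
  rw [htmul, TensorProduct.tmul_add, UniformSpace.Completion.coe_add]; rfl

theorem htmul_smul_right (a : ℂ) (c : K) (v : H) : htmul c (a • v) = a • htmul c v := by
  rw [htmul, TensorProduct.tmul_smul, UniformSpace.Completion.coe_smul]; rfl

variable (H) in
/-- `v ↦ c ⊗ v`, a bounded operator from `H` to `K ⊗ H`. -/
def leftTensor (c : K) : H →L[ℂ] HTensor K H :=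
  (UniformSpace.Completion.toComplL (𝕜 := ℂ) (E := K ⊗[ℂ] H)).comp (TensorProduct.mkL ℂ K H c)

variable (K) in
/-- `E_ξ = I ⊗ |ξ⟩ : c ↦ c ⊗ ξ`, a bounded operator from `K` to `K ⊗ H`. -/
def ketAmp (ξ : H) : K →L[ℂ] HTensor K H :=
  (UniformSpace.Completion.toComplL (𝕜 := ℂ) (E := K ⊗[ℂ] H)).comp
    ((TensorProduct.mkL ℂ K H).flip ξ)

@[simp] theorem leftTensor_apply (c : K) (v : H) : leftTensor H c v = htmul c v := rfl

@[simp] theorem ketAmp_apply (c : K) (ξ : H) : ketAmp K ξ c = htmul c ξ := rfl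

variable (K) in
/-- The ampliation `I ⊗ x` on `K ⊗ H` of a bounded operator `x` on `H`. -/
def amp (x : H →L[ℂ] H) : HTensor K H →L[ℂ] HTensor K H := (x.lTensor K).completion

@[simp] theorem amp_htmul (x : H →L[ℂ] H) (c : K) (v : H) :
    amp K x (htmul c v) = htmul c (x v) := by
  simp only [amp, htmul]
  exact UniformSpace.Completion.map_coe (x.lTensor K).uniformContinuous _

theorem htensor_ext_inner {a b : HTensor K H}
    (h : ∀ (c : K) (v : H), inner ℂ (htmul c v) a = inner ℂ (htmul c v) b) : a = b := by
  refine ext_inner_left ℂ fun w => ?_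
  induction w using UniformSpace.Completion.induction_on with
  | hp => exact isClosed_eq (by fun_prop) (by fun_prop)
  | ih w =>
    induction w using TensorProduct.induction_on with
    | zero => simp only [UniformSpace.Completion.coe_zero, inner_zero_left]
    | tmul c v => exact h c v
    | add p q hp hq => simp only [UniformSpace.Completion.coe_add, inner_add_left, hp, hq]

theorem htensor_clm_ext {G : Type*} [NormedAddCommGroup G] [NormedSpace ℂ G]
    {f g : HTensor K H →L[ℂ] G} (h : ∀ (c : K) (v : H), f (htmul c v) = g (htmul c v)) :
    f = g := by
  ext w
  induction w using UniformSpace.Completion.induction_on with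
  | hp => exact isClosed_eq (by fun_prop) (by fun_prop)
  | ih w =>
    induction w using TensorProduct.induction_on with
    | zero => simp only [UniformSpace.Completion.coe_zero, map_zero]
    | tmul c v => exact h c v
    | add p q hp hq => simp only [UniformSpace.Completion.coe_add, map_add, hp, hq]

variable (K H) in
/-- The ampliation `x ↦ I ⊗ x` as a linear map. -/
def ampₗ : (H →L[ℂ] H) →ₗ[ℂ] (HTensor K H →L[ℂ] HTensor K H) where
  toFun := amp K
  map_add' x y := htensor_clm_ext fun c v => by
    simp [htmul_add_right]
  map_smul' a x := htensor_clm_ext fun c v => by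
    simp [htmul_smul_right]

variable (K) in
/-- The canonical map from `K ⊗ D` (algebraic) to the Hilbert space tensor product `K ⊗ H`,
for a subspace `D` of `H`. -/
def algTensorMap (D : Submodule ℂ H) : K ⊗[ℂ] D →ₗ[ℂ] HTensor K H :=
  (UniformSpace.Completion.toComplL (𝕜 := ℂ) (E := K ⊗[ℂ] H)).toLinearMap ∘ₗ
    TensorProduct.map LinearMap.id D.subtype

variable (K) in
/-- The linear tensor product of `K` and the subspace `D` of `H`, realised in `K ⊗ H`: the linear
span of the vectors `c ⊗ v` with `v ∈ D`. -/
def algTensor (D : Submodule ℂ H) : Submodule ℂ (HTensor K H) := LinearMap.range (algTensorMap K D)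

theorem algTensorMap_injective (D : Submodule ℂ H) : Function.Injective (algTensorMap K D) := by
  have h1 : Function.Injective (TensorProduct.map (LinearMap.id : K →ₗ[ℂ] K) D.subtype) :=
    Module.Flat.lTensor_preserves_injective_linearMap (M := K) D.subtype D.injective_subtype
  exact (UniformSpace.Completion.coe_injective (K ⊗[ℂ] H)).comp h1

variable (K) in
/-- The linear tensor product in `K ⊗ H` is a copy of the algebraic tensor product. -/
def algTensorEquiv (D : Submodule ℂ H) : K ⊗[ℂ] D ≃ₗ[ℂ] algTensor K D :=
  LinearEquiv.ofInjective (algTensorMap K D) (algTensorMap_injective D)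

theorem htmul_mem_algTensor {D : Submodule ℂ H} (c : K) {v : H} (hv : v ∈ D) :
    htmul c v ∈ algTensor K D := ⟨c ⊗ₜ ⟨v, hv⟩, rfl⟩

theorem algTensor_eq_span (D : Submodule ℂ H) :
    algTensor K D = Submodule.span ℂ {w | ∃ c : K, ∃ v ∈ D, w = htmul c v} := by
  apply le_antisymm
  · rintro _ ⟨t, rfl⟩
    induction t using TensorProduct.induction_on with
    | zero => simp
    | tmul c v => exact Submodule.subset_span ⟨c, v, v.2, rfl⟩
    | add p q hp hq => rw [map_add]; exact Submodule.add_mem _ hp hq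
  · rw [Submodule.span_le]
    rintro _ ⟨c, v, hv, rfl⟩
    exact htmul_mem_algTensor c hv

/-- The operator `c ↦ T (c ⊗ ξ)`, written `T E_ξ`, for an operator `T` whose domain is the linear
tensor product of `K` and `D`, where `ξ ∈ D`. -/
def atVec {D : Submodule ℂ H} {ξ : H} (hξ : ξ ∈ D) {G : Type*} [AddCommGroup G] [Module ℂ G]
    (T : algTensor K D →ₗ[ℂ] G) : K →ₗ[ℂ] G :=
  T ∘ₗ (ketAmp K ξ).toLinearMap.codRestrict (algTensor K D) fun c => htmul_mem_algTensor c hξ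

/-- For a bounded operator `A : K₁ → K₂` and an operator `X` with domain `D`, the operator
`A ⊗ X` with domain the linear tensor product of `K₁` and `D`, `c ⊗ v ↦ A c ⊗ X v`. -/
def tensorOp {K₁ K₂ : Type*} [NormedAddCommGroup K₁] [InnerProductSpace ℂ K₁]
    [NormedAddCommGroup K₂] [InnerProductSpace ℂ K₂] {D : Submodule ℂ H}
    (A : K₁ →L[ℂ] K₂) (X : D →ₗ[ℂ] H) : algTensor K₁ D →ₗ[ℂ] HTensor K₂ H :=
  (UniformSpace.Completion.toComplL (𝕜 := ℂ) (E := K₂ ⊗[ℂ] H)).toLinearMap ∘ₗ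
    TensorProduct.map A.toLinearMap X ∘ₗ (algTensorEquiv K₁ D).symm.toLinearMap

/-- `A ⊗ X` acts on simple tensors as it should. -/
theorem tensorOp_htmul {K₁ K₂ : Type*} [NormedAddCommGroup K₁] [InnerProductSpace ℂ K₁]
    [NormedAddCommGroup K₂] [InnerProductSpace ℂ K₂] {D : Submodule ℂ H}
    (A : K₁ →L[ℂ] K₂) (X : D →ₗ[ℂ] H) (c : K₁) (v : D) :
    tensorOp A X ⟨htmul c (v : H), htmul_mem_algTensor c v.2⟩ = htmul (A c) (X v) := by
  have : (algTensorEquiv K₁ D).symm ⟨htmul c (v : H), htmul_mem_algTensor c v.2⟩ = c ⊗ₜ v := by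
    rw [LinearEquiv.symm_apply_eq]; rfl
  simp only [tensorOp, LinearMap.comp_apply, LinearEquiv.coe_coe, this]
  rfl

end HilbertTensor

/-! ### Hilbert–Schmidt operators, conjugations, transposes -/

/-- An everywhere defined linear operator is Hilbert–Schmidt if it is bounded and
`∑ ‖B e‖²` is finite for `e` running through an orthonormal basis. -/
def IsHilbertSchmidt {E F : Type*} [NormedAddCommGroup E] [InnerProductSpace ℂ E]
    [NormedAddCommGroup F] [InnerProductSpace ℂ F] (B : E →ₗ[ℂ] F) : Prop :=
  Continuous B ∧ ∃ (s : Set E) (b : HilbertBasis s ℂ E), Summable fun i => ‖B (b i)‖ ^ 2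

/-- A conjugation on a complex Hilbert space: a conjugate-linear isometric involution.
Equivalently, a realisation of `K` as the complexification of a real Hilbert space. -/
structure HilbertConj (K : Type*) [NormedAddCommGroup K] [InnerProductSpace ℂ K] where
  /-- The underlying antiunitary operator. -/
  toEquiv : K ≃ₗᵢ⋆[ℂ] K
  involutive : ∀ c, toEquiv (toEquiv c) = c

instance {K : Type*} [NormedAddCommGroup K] [InnerProductSpace ℂ K] :
    CoeFun (HilbertConj K) fun _ => K → K := ⟨fun k => k.toEquiv⟩

/-- Complex conjugation on `ℂ`. -/
def HilbertConj.complex : HilbertConj ℂ where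
  toEquiv := starₗᵢ ℂ
  involutive c := by simp

theorem antiunitary_inner {E F : Type*} [NormedAddCommGroup E] [InnerProductSpace ℂ E]
    [NormedAddCommGroup F] [InnerProductSpace ℂ F] (k : E ≃ₗᵢ⋆[ℂ] F) (x y : E) :
    inner ℂ (k x) (k y) = inner ℂ y x := by
  rw [inner_eq_sum_norm_sq_div_four (k x) (k y), inner_eq_sum_norm_sq_div_four y x]
  have h1 : ‖k x + k y‖ = ‖y + x‖ := by rw [← map_add, k.norm_map, add_comm]
  have h2 : ‖k x - k y‖ = ‖y - x‖ := by rw [← map_sub, k.norm_map, norm_sub_rev]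
  have h3 : ‖k x - (RCLike.I : ℂ) • k y‖ = ‖y - (RCLike.I : ℂ) • x‖ := by
    have : k x - (RCLike.I : ℂ) • k y = k (x + (RCLike.I : ℂ) • y) := by
      rw [map_add, LinearIsometryEquiv.map_smulₛₗ]; simp [sub_eq_add_neg]
    rw [this, k.norm_map]
    have : x + (RCLike.I : ℂ) • y = (RCLike.I : ℂ) • (y - (RCLike.I : ℂ) • x) := by
      rw [smul_sub, smul_smul]; simp [add_comm]
    rw [this, norm_smul]; simp
  have h4 : ‖k x + (RCLike.I : ℂ) • k y‖ = ‖y + (RCLike.I : ℂ) • x‖ := by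
    have : k x + (RCLike.I : ℂ) • k y = k (x - (RCLike.I : ℂ) • y) := by
      rw [map_sub, LinearIsometryEquiv.map_smulₛₗ]; simp [sub_eq_add_neg]
    rw [this, k.norm_map]
    have : x - (RCLike.I : ℂ) • y = -((RCLike.I : ℂ) • (y + (RCLike.I : ℂ) • x)) := by
      rw [smul_add, smul_smul]; simp [sub_eq_add_neg]
    rw [this, norm_neg, norm_smul]; simp
  rw [h1, h2, h3, h4]

theorem HilbertConj.inner_left {K : Type*} [NormedAddCommGroup K] [InnerProductSpace ℂ K]
    (k : HilbertConj K) (x y : K) : inner ℂ (k x) y = inner ℂ (k y) x := by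
  conv_lhs => rw [← k.involutive y]
  exact antiunitary_inner k.toEquiv x (k y)

section Transpose

variable {K₁ K₂ H : Type*}
  [NormedAddCommGroup K₁] [InnerProductSpace ℂ K₁]
  [NormedAddCommGroup K₂] [InnerProductSpace ℂ K₂]
  [NormedAddCommGroup H] [InnerProductSpace ℂ H]

/-- The conjugate operator `k₂ B k₁` of a bounded operator. -/
def conjOp (k₁ : HilbertConj K₁) (k₂ : HilbertConj K₂) (B : K₁ →L[ℂ] K₂) : K₁ →L[ℂ] K₂ where
  toFun c := k₂ (B (k₁ c))
  map_add' x y := by simp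
  map_smul' a x := by simp [LinearIsometryEquiv.map_smulₛₗ]
  cont := k₂.toEquiv.continuous.comp (B.continuous.comp k₁.toEquiv.continuous)

/-- The transpose of a bounded operator: the adjoint of its conjugate. -/
def transposeOp [CompleteSpace K₁] [CompleteSpace K₂] (k₁ : HilbertConj K₁) (k₂ : HilbertConj K₂)
    (B : K₁ →L[ℂ] K₂) : K₂ →L[ℂ] K₁ := ContinuousLinearMap.adjoint (conjOp k₁ k₂ B)

/-- `B'` is the partial transpose of `B`:
`⟪c₁ ⊗ v, B' c₂⟫ = ⟪k₂ c₂ ⊗ v, B (k₁ c₁)⟫`. -/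
def IsPartialTranspose (k₁ : HilbertConj K₁) (k₂ : HilbertConj K₂)
    (B : K₁ →ₗ[ℂ] HTensor K₂ H) (B' : K₂ →L[ℂ] HTensor K₁ H) : Prop :=
  ∀ (c₁ : K₁) (c₂ : K₂) (v : H),
    inner ℂ (htmul c₁ v) (B' c₂) = inner ℂ (htmul (k₂ c₂) v) (B (k₁ c₁))

theorem norm_adjoint_leftTensor_le [CompleteSpace H] (c : K₂) (w : HTensor K₂ H) :
    ‖ContinuousLinearMap.adjoint (leftTensor H c) w‖ ≤ ‖c‖ * ‖w‖ := by
  refine (ContinuousLinearMap.le_opNorm _ _).trans ?_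
  gcongr
  rw [LinearIsometryEquiv.norm_map]
  refine ContinuousLinearMap.opNorm_le_bound _ (norm_nonneg _) fun v => ?_
  simp [htmul]

/-- A Hilbert–Schmidt operator from `K₁` to `K₂ ⊗ H` has one and only one partial transpose. -/
theorem existsUnique_partialTranspose [CompleteSpace K₁] [CompleteSpace H]
    (k₁ : HilbertConj K₁) (k₂ : HilbertConj K₂)
    (B : K₁ →ₗ[ℂ] HTensor K₂ H) (hB : IsHilbertSchmidt B) :
    ∃! B' : K₂ →L[ℂ] HTensor K₁ H, IsPartialTranspose k₁ k₂ B B' := by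
  obtain ⟨hcont, s, b, hs⟩ := hB
  have hf : Orthonormal ℂ fun i => k₁ (b i) := by
    constructor
    · intro i; rw [k₁.toEquiv.norm_map]; exact b.orthonormal.1 i
    · intro i j hij
      rw [antiunitary_inner]; exact b.orthonormal.2 hij.symm
  let V : s → H →ₗᵢ[ℂ] HTensor K₁ H := fun i =>
    { (leftTensor H (k₁ (b i))).toLinearMap with
      norm_map' := fun v => by
        change ‖htmul (k₁ (b i)) v‖ = ‖v‖
        rw [htmul, UniformSpace.Completion.norm_coe, TensorProduct.norm_tmul, hf.1 i, one_mul] }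
  have hV : OrthogonalFamily ℂ (fun _ : s => H) V := by
    intro i j hij v w
    change inner ℂ (htmul (k₁ (b i)) v) (htmul (k₁ (b j)) w) = 0
    rw [inner_htmul, hf.2 hij, zero_mul]
  let a : K₂ → s → H := fun c i =>
    ContinuousLinearMap.adjoint (leftTensor H (k₂ c)) (B (b i))
  have ha : ∀ c i v, inner ℂ v (a c i) = inner ℂ (htmul (k₂ c) v) (B (b i)) := fun c i v => by
    rw [ContinuousLinearMap.adjoint_inner_right]; rfl
  have hbd : ∀ c i, ‖a c i‖ ^ 2 ≤ ‖c‖ ^ 2 * ‖B (b i)‖ ^ 2 := fun c i => by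
    rw [← mul_pow]
    have := norm_adjoint_leftTensor_le (H := H) (k₂ c) (B (b i))
    rw [k₂.toEquiv.norm_map] at this
    gcongr
  have hsum2 : ∀ c, Summable fun i => ‖a c i‖ ^ 2 := fun c =>
    Summable.of_nonneg_of_le (fun i => by positivity) (hbd c) (hs.mul_left _)
  have hsum : ∀ c, Summable fun i => V i (a c i) := fun c =>
    (hV.summable_iff_norm_sq_summable (a c)).2 (hsum2 c)
  have hadd : ∀ c c' i, a (c + c') i = a c i + a c' i := fun c c' i => by
    refine ext_inner_left ℂ fun v => ?_
    rw [inner_add_right, ha, ha, ha, map_add]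
    rw [htmul_add_left, inner_add_left]
  have hsmul : ∀ (z : ℂ) c i, a (z • c) i = z • a c i := fun z c i => by
    refine ext_inner_left ℂ fun v => ?_
    rw [inner_smul_right, ha, ha, LinearIsometryEquiv.map_smulₛₗ]
    rw [htmul_smul_left, inner_smul_left, starRingEnd_self_apply]
  let L : K₂ →ₗ[ℂ] HTensor K₁ H :=
    { toFun := fun c => ∑' i, V i (a c i)
      map_add' := fun c c' => by
        rw [← (hsum c).tsum_add (hsum c')]
        simp only [hadd, map_add]
      map_smul' := fun z c => by
        rw [RingHom.id_apply, ← (hsum c).tsum_const_smul]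
        simp only [hsmul, map_smul] }
  have hL : ∀ c, ‖L c‖ ≤ Real.sqrt (∑' i, ‖B (b i)‖ ^ 2) * ‖c‖ := fun c => by
    refine le_of_tendsto (hsum c).hasSum.norm (Filter.Eventually.of_forall fun t => ?_)
    refine abs_le_of_sq_le_sq' ?_ (by positivity) |>.2
    rw [hV.norm_sum, mul_pow, Real.sq_sqrt (tsum_nonneg fun i => by positivity)]
    calc ∑ i ∈ t, ‖a c i‖ ^ 2 ≤ ∑ i ∈ t, ‖c‖ ^ 2 * ‖B (b i)‖ ^ 2 :=
          Finset.sum_le_sum fun i _ => hbd c i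
      _ = ‖c‖ ^ 2 * ∑ i ∈ t, ‖B (b i)‖ ^ 2 := by rw [Finset.mul_sum]
      _ ≤ ‖c‖ ^ 2 * ∑' i, ‖B (b i)‖ ^ 2 := by
          gcongr
          exact hs.sum_le_tsum t fun i _ => by positivity
      _ = _ := mul_comm _ _
  have key : IsPartialTranspose k₁ k₂ B (L.mkContinuous _ hL) := by
    intro c₁ c₂ v
    rw [LinearMap.mkContinuous_apply]
    have h1 : HasSum (fun i => inner ℂ (htmul c₁ v) (V i (a c₂ i)))
        (inner ℂ (htmul c₁ v) (L c₂)) :=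
      (hsum c₂).hasSum.mapL (innerSL ℂ (htmul c₁ v))
    have h2 : HasSum (fun i => inner ℂ (htmul (k₂ c₂) v) (B (b.repr (k₁ c₁) i • b i)))
        (inner ℂ (htmul (k₂ c₂) v) (B (k₁ c₁))) :=
      ((b.hasSum_repr (k₁ c₁)).mapL ⟨B, hcont⟩).mapL (innerSL ℂ (htmul (k₂ c₂) v))
    refine h1.unique ?_
    convert h2 using 2 with i
    change inner ℂ (htmul c₁ v) (htmul (k₁ (b i)) (a c₂ i)) = _
    rw [inner_htmul, ha, map_smul, inner_smul_right, b.repr_apply_apply]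
    congr 1
    rw [← antiunitary_inner k₁.toEquiv, k₁.involutive]
  refine ⟨L.mkContinuous _ hL, key, fun B' hB' => ?_⟩
  ext c
  exact htensor_ext_inner fun c₁ v => (hB' c₁ c v).trans (key c₁ c v).symm

open Classical in
/-- The partial transpose of a Hilbert–Schmidt operator from `K₁` to `K₂ ⊗ H`. -/
def partialTranspose [CompleteSpace K₁] [CompleteSpace H]
    (k₁ : HilbertConj K₁) (k₂ : HilbertConj K₂)
    (B : K₁ →ₗ[ℂ] HTensor K₂ H) : K₂ →L[ℂ] HTensor K₁ H :=
  if hB : IsHilbertSchmidt B then (existsUnique_partialTranspose k₁ k₂ B hB).choose else 0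

end Transpose

/-! ### Affiliated unbounded operators -/

section Affiliated

variable {H : Type*} [NormedAddCommGroup H] [InnerProductSpace ℂ H] [CompleteSpace H]
  {F₁ : Type*} [NormedAddCommGroup F₁] [InnerProductSpace ℂ F₁]
  {F₂ : Type*} [NormedAddCommGroup F₂] [InnerProductSpace ℂ F₂]

/- In this section `F₁` and `F₂` stand for `H` itself or a tensor product `K ⊗ H`, and `a₁`, `a₂`
say how an operator `x` on `H` is ampliated to these: by `x` itself (`a = id`), respectively by
`I ⊗ x` (`a = amp K`). -/

/-- A possibly unbounded operator `T` is affiliated to `M` if `(I ⊗ u*) T (I ⊗ u) = T` for all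
unitaries `u` in the commutant of `M`, an equality of operators, domains included:
`(x, y)` is in the graph of the left-hand side if and only if `((I ⊗ u) x, (I ⊗ u) y)` is in the
graph of `T`. -/
def IsAffiliated (M : VonNeumannAlgebra H) (a₁ : (H →L[ℂ] H) → F₁ →L[ℂ] F₁)
    (a₂ : (H →L[ℂ] H) → F₂ →L[ℂ] F₂) (T : F₁ →ₗ.[ℂ] F₂) : Prop :=
  ∀ u ∈ M.commutant, u ∈ unitary (H →L[ℂ] H) →
    ∀ x y, (a₁ u x, a₂ u y) ∈ T.graph ↔ (x, y) ∈ T.graph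

/-- The operators with domain `D₁` which are affiliated to `M`. An operator with domain `D₁` is a
linear map defined on `D₁`. -/
def OpAff (M : VonNeumannAlgebra H) (a₁ : (H →L[ℂ] H) → F₁ →L[ℂ] F₁)
    (a₂ : (H →L[ℂ] H) → F₂ →L[ℂ] F₂) (D₁ : Submodule ℂ F₁) : Set (D₁ →ₗ[ℂ] F₂) :=
  {T | IsAffiliated M a₁ a₂ (LinearPMap.mk D₁ T)}

/-- The operators with dense domain `D₁` whose (Hilbert space) adjoint has a domain which contains
the dense subspace `D₂`. -/
def OpDag [CompleteSpace F₁] (D₁ : Submodule ℂ F₁) (D₂ : Submodule ℂ F₂) : Set (D₁ →ₗ[ℂ] F₂) :=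
  {T | D₂ ≤ (LinearPMap.mk D₁ T).adjoint.domain}

open Classical in
/-- `T† := (T*)|_{D₂}`, for `T` with dense domain `D₁` and with `D₂` contained in the domain of
its adjoint `T*` (and zero for other `T`). -/
def dag [CompleteSpace F₁] {D₁ : Submodule ℂ F₁} (D₂ : Submodule ℂ F₂) (T : D₁ →ₗ[ℂ] F₂) :
    D₂ →ₗ[ℂ] F₁ :=
  if h : D₂ ≤ (LinearPMap.mk D₁ T).adjoint.domain then
    (LinearPMap.mk D₁ T).adjoint.toFun ∘ₗ Submodule.inclusion h
  else 0

/-- The members of `OpDag` which are affiliated to `M`. -/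
def OpDagAff [CompleteSpace F₁] (M : VonNeumannAlgebra H) (a₁ : (H →L[ℂ] H) → F₁ →L[ℂ] F₁)
    (a₂ : (H →L[ℂ] H) → F₂ →L[ℂ] F₂) (D₁ : Submodule ℂ F₁) (D₂ : Submodule ℂ F₂) :
    Set (D₁ →ₗ[ℂ] F₂) :=
  OpDag D₁ D₂ ∩ OpAff M a₁ a₂ D₁

end Affiliated

/-! ### Cyclic and separating vectors, the Tomita–Takesaki operator -/

section Tomita

variable {H : Type*} [NormedAddCommGroup H] [InnerProductSpace ℂ H] [CompleteSpace H]

/-- The linear map `x ↦ x ξ` on a von Neumann algebra. -/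
def evalAt (N : VonNeumannAlgebra H) (ξ : H) : N.toStarSubalgebra →ₗ[ℂ] H where
  toFun x := (x : H →L[ℂ] H) ξ
  map_add' _ _ := rfl
  map_smul' _ _ := rfl

/-- The subspace `N ξ`. -/
def orbit (N : VonNeumannAlgebra H) (ξ : H) : Submodule ℂ H := LinearMap.range (evalAt N ξ)

theorem mem_orbit {N : VonNeumannAlgebra H} {ξ h : H} : h ∈ orbit N ξ ↔ ∃ x ∈ N, x ξ = h :=
  ⟨fun ⟨x, hx⟩ => ⟨x, x.2, hx⟩, fun ⟨x, hx, h⟩ => ⟨⟨x, hx⟩, h⟩⟩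

theorem self_mem_orbit (N : VonNeumannAlgebra H) (ξ : H) : ξ ∈ orbit N ξ :=
  mem_orbit.2 ⟨1, one_mem N, rfl⟩

/-- `ξ` is cyclic and separating for `M`. -/
structure IsCyclicSeparating (M : VonNeumannAlgebra H) (ξ : H) : Prop where
  cyclic : Dense (orbit M ξ : Set H)
  separating : ∀ x ∈ M, x ξ = 0 → x = 0

theorem evalAt_injective {N : VonNeumannAlgebra H} {ξ : H} (h : ∀ x ∈ N, x ξ = 0 → x = 0) :
    Function.Injective (evalAt N ξ) := by
  rw [injective_iff_map_eq_zero]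
  intro x hx
  exact Subtype.ext (h x x.2 hx)

/-- `N` is in bijection with `N ξ` if `ξ` is separating for `N`. -/
def orbitEquiv {N : VonNeumannAlgebra H} {ξ : H} (h : ∀ x ∈ N, x ξ = 0 → x = 0) :
    N.toStarSubalgebra ≃ₗ[ℂ] orbit N ξ :=
  LinearEquiv.ofInjective (evalAt N ξ) (evalAt_injective h)

variable {M : VonNeumannAlgebra H} {ξ : H}

theorem IsCyclicSeparating.separating_commutant (hξ : IsCyclicSeparating M ξ) :
    ∀ x ∈ M.commutant, x ξ = 0 → x = 0 := by
  intro x hx h0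
  have : (x : H → H) = (0 : H →L[ℂ] H) := by
    refine x.continuous.ext_on hξ.cyclic continuous_const ?_
    rintro _ ⟨y, rfl⟩
    change x ((y : H →L[ℂ] H) ξ) = 0
    have := congrArg (fun z : H →L[ℂ] H => z ξ) (VonNeumannAlgebra.mem_commutant_iff.1 hx y y.2)
    change (y : H →L[ℂ] H) (x ξ) = x ((y : H →L[ℂ] H) ξ) at this
    rw [← this, h0, map_zero]
  exact DFunLike.coe_injective this

theorem IsCyclicSeparating.dense_commutant (hξ : IsCyclicSeparating M ξ) :
    Dense (orbit M.commutant ξ : Set H) := by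
  let P := (orbit M.commutant ξ).topologicalClosure
  have hp : P.starProjection ∈ M := by
    rw [VonNeumannAlgebra.IsStarProjection.mem_iff isStarProjection_starProjection]
    intro y hy
    rw [Module.End.mem_invtSubmodule, Submodule.range_starProjection]
    intro h hh
    rw [Submodule.mem_comap]
    refine map_mem_closure (f := y) y.continuous hh ?_
    rintro _ ⟨x, rfl⟩
    exact mem_orbit.2 ⟨y * x, mul_mem hy x.2, rfl⟩
  have hξP : P.starProjection ξ = ξ := by
    rw [Submodule.starProjection_eq_self_iff]
    exact Submodule.le_topologicalClosure _ (self_mem_orbit _ _)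
  have h0 := hξ.separating (1 - P.starProjection) (sub_mem (one_mem M) hp)
    (by change ξ - P.starProjection ξ = 0; rw [hξP, sub_self])
  rw [sub_eq_zero] at h0
  intro h
  have : P.starProjection h = h := by rw [← h0]; rfl
  rw [Submodule.starProjection_eq_self_iff] at this
  exact this

/-- The closure of the graph of a conjugate-linear operator. -/
def graphClosure {E F : Type*} [NormedAddCommGroup E] [NormedSpace ℂ E] [NormedAddCommGroup F]
    [NormedSpace ℂ F] (T : E →ₛₗ.[starRingEnd ℂ] F) : Set (E × F) :=
  closure (Set.range fun x : T.domain => ((x : E), T x))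

section Closure

variable {E F : Type*} [NormedAddCommGroup E] [NormedSpace ℂ E] [NormedAddCommGroup F]
    [NormedSpace ℂ F] {T : E →ₛₗ.[starRingEnd ℂ] F}

theorem graphClosure_zero : ((0 : E), (0 : F)) ∈ graphClosure T :=
  subset_closure ⟨0, by simp⟩

theorem graphClosure_add {p q : E × F} (hp : p ∈ graphClosure T) (hq : q ∈ graphClosure T) :
    p + q ∈ graphClosure T := by
  refine map_mem_closure₂ (f := fun p q : E × F => p + q) continuous_add hp hq ?_
  rintro _ ⟨x, rfl⟩ _ ⟨y, rfl⟩
  exact ⟨x + y, by simp [LinearPMap.map_add]⟩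

theorem graphClosure_smul (a : ℂ) {p : E × F} (hp : p ∈ graphClosure T) :
    (a • p.1, conj a • p.2) ∈ graphClosure T := by
  refine map_mem_closure (f := fun p : E × F => (a • p.1, conj a • p.2)) (by fun_prop) hp ?_
  rintro _ ⟨x, rfl⟩
  exact ⟨a • x, by simp [LinearPMap.map_smulₛₗ]⟩

theorem graphClosure_unique (hT : ∀ y, ((0 : E), y) ∈ graphClosure T → y = 0) {x : E} {y y' : F}
    (h : (x, y) ∈ graphClosure T) (h' : (x, y') ∈ graphClosure T) : y = y' := by
  have := graphClosure_add h (graphClosure_smul (-1) h')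
  rw [← sub_eq_zero]
  apply hT
  simpa [sub_eq_add_neg] using this

/-- The closure of a closable conjugate-linear operator: the operator whose graph is the closure of
the graph of `T`. -/
def antilinearClosure (T : E →ₛₗ.[starRingEnd ℂ] F)
    (hT : ∀ y, ((0 : E), y) ∈ graphClosure T → y = 0) : E →ₛₗ.[starRingEnd ℂ] F where
  domain :=
    { carrier := {x | ∃ y, (x, y) ∈ graphClosure T}
      add_mem' := fun ⟨y, hy⟩ ⟨y', hy'⟩ => ⟨y + y', graphClosure_add hy hy'⟩
      zero_mem' := ⟨0, graphClosure_zero⟩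
      smul_mem' := fun a _ ⟨y, hy⟩ => ⟨conj a • y, graphClosure_smul a hy⟩ }
  toFun :=
    { toFun := fun x => x.2.choose
      map_add' := fun x x' => graphClosure_unique hT (x + x').2.choose_spec
        (graphClosure_add x.2.choose_spec x'.2.choose_spec)
      map_smul' := fun a x => graphClosure_unique hT (a • x).2.choose_spec
        (graphClosure_smul a x.2.choose_spec) }

theorem mem_graphClosure_iff (hT : ∀ y, ((0 : E), y) ∈ graphClosure T → y = 0) {x : E} {y : F} :
    (x, y) ∈ graphClosure T ↔
      ∃ h : x ∈ (antilinearClosure T hT).domain, antilinearClosure T hT ⟨x, h⟩ = y := by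
  constructor
  · intro h
    exact ⟨⟨y, h⟩, graphClosure_unique hT
      (Exists.choose_spec (p := fun y => (x, y) ∈ graphClosure T) ⟨y, h⟩) h⟩
  · rintro ⟨h, rfl⟩
    exact h.choose_spec

theorem graphClosure_inner {E F : Type*} [NormedAddCommGroup E] [InnerProductSpace ℂ E]
    [NormedAddCommGroup F] [InnerProductSpace ℂ F] {T : E →ₛₗ.[starRingEnd ℂ] F} {d : F} {d' : E}
    (h : ∀ x : T.domain, inner ℂ d (T x) = inner ℂ (x : E) d') {p : E × F}
    (hp : p ∈ graphClosure T) : inner ℂ d p.2 = inner ℂ p.1 d' := by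
  have hc : IsClosed {p : E × F | inner ℂ d p.2 = inner ℂ p.1 d'} :=
    isClosed_eq (by fun_prop) (by fun_prop)
  refine closure_minimal ?_ hc hp
  rintro _ ⟨x, rfl⟩
  exact h x

end Closure

/-- The conjugate-linear operator `x ξ ↦ x* ξ` with domain `M ξ`. -/
def tomitaCore (hξ : IsCyclicSeparating M ξ) : H →ₛₗ.[starRingEnd ℂ] H where
  domain := orbit M ξ
  toFun :=
    { toFun := fun h => star ((orbitEquiv hξ.separating).symm h : H →L[ℂ] H) ξ
      map_add' := fun h h' => by simp
      map_smul' := fun a h => by simp }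

theorem tomitaCore_inner (hξ : IsCyclicSeparating M ξ) (h : (tomitaCore hξ).domain)
    {x : H →L[ℂ] H} (hx : x ∈ M.commutant) :
    inner ℂ (x ξ) (tomitaCore hξ h) = inner ℂ (h : H) (star x ξ) := by
  obtain ⟨y, hy⟩ := (orbitEquiv hξ.separating).surjective h
  have h1 : tomitaCore hξ h = star (y : H →L[ℂ] H) ξ := by
    change star ((orbitEquiv hξ.separating).symm h : H →L[ℂ] H) ξ = _
    rw [← hy, LinearEquiv.symm_apply_apply]
  have h2 : (h : H) = (y : H →L[ℂ] H) ξ := by rw [← hy]; rfl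
  have h3 := congrArg (fun z : H →L[ℂ] H => z ξ) (VonNeumannAlgebra.mem_commutant_iff.1 hx y y.2)
  change (y : H →L[ℂ] H) (x ξ) = x ((y : H →L[ℂ] H) ξ) at h3
  rw [h1, h2, ContinuousLinearMap.star_eq_adjoint, ContinuousLinearMap.star_eq_adjoint,
    ContinuousLinearMap.adjoint_inner_right, ContinuousLinearMap.adjoint_inner_right, h3]

theorem tomitaCore_closable (hξ : IsCyclicSeparating M ξ) :
    ∀ y, ((0 : H), y) ∈ graphClosure (tomitaCore hξ) → y = 0 := by
  intro y hy
  refine hξ.dense_commutant.eq_of_inner_right ℂ fun v hv => ?_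
  obtain ⟨x, hx, rfl⟩ := mem_orbit.1 hv
  rw [graphClosure_inner (fun h => tomitaCore_inner hξ h hx) hy]
  simp

/-- The Tomita–Takesaki operator `S_ξ`: the closure of `x ξ ↦ x* ξ`, `x ∈ M`. -/
def tomita (hξ : IsCyclicSeparating M ξ) : H →ₛₗ.[starRingEnd ℂ] H :=
  antilinearClosure (tomitaCore hξ) (tomitaCore_closable hξ)

theorem tomita_inner (hξ : IsCyclicSeparating M ξ) (h : (tomita hξ).domain)
    {x : H →L[ℂ] H} (hx : x ∈ M.commutant) :
    inner ℂ (x ξ) (tomita hξ h) = inner ℂ (h : H) (star x ξ) :=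
  graphClosure_inner (fun h => tomitaCore_inner hξ h hx)
    ((mem_graphClosure_iff (tomitaCore_closable hξ)).2 ⟨h.2, rfl⟩)

end Tomita

section ConjTensor

variable {K : Type*} [NormedAddCommGroup K] [InnerProductSpace ℂ K]
  {H : Type*} [NormedAddCommGroup H] [InnerProductSpace ℂ H]

/-- The linear tensor product of a conjugation `k` and a conjugate-linear operator `S`:
`c ⊗ v ↦ k c ⊗ S v` on the linear tensor product of `K` and the domain of `S`. -/
def conjTensorCore (k : HilbertConj K) (S : H →ₛₗ.[starRingEnd ℂ] H) :
    HTensor K H →ₛₗ.[starRingEnd ℂ] HTensor K H where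
  domain := algTensor K S.domain
  toFun := (UniformSpace.Completion.toComplL (𝕜 := ℂ) (E := K ⊗[ℂ] H)).toLinearMap ∘ₛₗ
    TensorProduct.map k.toEquiv.toLinearEquiv.toLinearMap S.toFun ∘ₛₗ
    (algTensorEquiv K S.domain).symm.toLinearMap

theorem conjTensorCore_htmul (k : HilbertConj K) (S : H →ₛₗ.[starRingEnd ℂ] H) (c : K)
    (v : S.domain) :
    conjTensorCore k S ⟨htmul c (v : H), htmul_mem_algTensor c v.2⟩ = htmul (k c) (S v) := by
  have : (algTensorEquiv K S.domain).symm ⟨htmul c (v : H), htmul_mem_algTensor c v.2⟩ =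
      c ⊗ₜ v := by
    rw [LinearEquiv.symm_apply_eq]; rfl
  change ((TensorProduct.map k.toEquiv.toLinearEquiv.toLinearMap S.toFun
    ((algTensorEquiv K S.domain).symm ⟨htmul c (v : H), _⟩) : K ⊗[ℂ] H) : HTensor K H) = _
  rw [this]
  rfl

variable [CompleteSpace H] {M : VonNeumannAlgebra H} {ξ : H}

theorem conjTensorCore_inner (k : HilbertConj K) (hξ : IsCyclicSeparating M ξ)
    (w : (conjTensorCore k (tomita hξ)).domain) (c : K) {x : H →L[ℂ] H} (hx : x ∈ M.commutant) :
    inner ℂ (htmul c (x ξ)) (conjTensorCore k (tomita hξ) w) =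
      inner ℂ (w : HTensor K H) (htmul (k c) (star x ξ)) := by
  let e : K ⊗[ℂ] (tomita hξ).domain ≃ₗ[ℂ] (conjTensorCore k (tomita hξ)).domain :=
    algTensorEquiv K (tomita hξ).domain
  obtain ⟨t, rfl⟩ := e.surjective w
  induction t using TensorProduct.induction_on with
  | zero => rw [map_zero, LinearPMap.map_zero]; simp
  | tmul c' v =>
    have h := conjTensorCore_htmul k (tomita hξ) c' v
    change inner ℂ _ (conjTensorCore k (tomita hξ) ⟨htmul c' (v : H), _⟩) =
      inner ℂ (htmul c' (v : H)) _
    rw [h, inner_htmul, inner_htmul, tomita_inner hξ v hx]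
    congr 1
    rw [← antiunitary_inner k.toEquiv (k c), k.involutive]
  | add p q hp hq =>
    rw [map_add, LinearPMap.map_add, inner_add_right, hp, hq, ← inner_add_left]
    rfl

theorem conjTensorCore_closable (k : HilbertConj K) (hξ : IsCyclicSeparating M ξ) :
    ∀ y, ((0 : HTensor K H), y) ∈ graphClosure (conjTensorCore k (tomita hξ)) → y = 0 := by
  intro y hy
  refine htensor_ext_inner fun c v => ?_
  rw [inner_zero_right]
  have hc : Continuous fun v : H => inner ℂ (htmul c v) y :=
    (leftTensor H c).continuous.inner continuous_const
  refine congrFun (hc.ext_on hξ.dense_commutant (continuous_const (y := (0 : ℂ))) ?_) v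
  intro v hv
  obtain ⟨x, hx, rfl⟩ := mem_orbit.1 hv
  change inner ℂ (htmul c (x ξ)) y = 0
  rw [graphClosure_inner (fun w => conjTensorCore_inner k hξ w c hx) hy]
  simp

/-- The conjugate-linear operator `k ⊗ S_ξ`: the closure of the linear tensor product of the
conjugation `k` and the Tomita–Takesaki operator. -/
def conjTomita (k : HilbertConj K) (hξ : IsCyclicSeparating M ξ) :
    HTensor K H →ₛₗ.[starRingEnd ℂ] HTensor K H :=
  antilinearClosure (conjTensorCore k (tomita hξ)) (conjTensorCore_closable k hξ)

end ConjTensor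

/-! ### Matrix spaces associated to `(M, ξ)` -/

section Matrix

variable {H : Type*} [NormedAddCommGroup H] [InnerProductSpace ℂ H] [CompleteSpace H]

/-- `Ξ = M' ξ`. -/
abbrev XiSpace (M : VonNeumannAlgebra H) (ξ : H) : Submodule ℂ H := orbit M.commutant ξ

variable {M : VonNeumannAlgebra H} {ξ : H}
  {K₁ : Type*} [NormedAddCommGroup K₁] [InnerProductSpace ℂ K₁]
  {K₂ : Type*} [NormedAddCommGroup K₂] [InnerProductSpace ℂ K₂]

/-- `T E_ξ : c ↦ T (c ⊗ ξ)`, for an operator `T` defined on the linear tensor product of `K₁`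
and `Ξ`. -/
def onXi {G : Type*} [AddCommGroup G] [Module ℂ G]
    (T : algTensor K₁ (XiSpace M ξ) →ₗ[ℂ] G) : K₁ →ₗ[ℂ] G :=
  atVec (self_mem_orbit M.commutant ξ) T

/-- The operator `B^ξ`, with domain the linear tensor product of `K₁` and `Ξ`:
`c ⊗ x' ξ ↦ (I ⊗ x') B c` for `c ∈ K₁` and `x' ∈ M'`. -/
def ofMatrix (hξ : IsCyclicSeparating M ξ) (B : K₁ →ₗ[ℂ] HTensor K₂ H) :
    algTensor K₁ (XiSpace M ξ) →ₗ[ℂ] HTensor K₂ H :=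
  TensorProduct.lift (LinearMap.mk₂ ℂ
    (fun (c : K₁) (h : XiSpace M ξ) =>
      amp K₂ ((orbitEquiv hξ.separating_commutant).symm h : H →L[ℂ] H) (B c))
    (fun c c' h => by simp)
    (fun a c h => by simp)
    (fun c h h' => by
      have := (ampₗ K₂ H).map_add ((orbitEquiv hξ.separating_commutant).symm h : H →L[ℂ] H)
        ((orbitEquiv hξ.separating_commutant).symm h' : H →L[ℂ] H)
      rw [map_add]
      exact congrArg (fun z => z (B c)) this)
    (fun a c h => by
      have := (ampₗ K₂ H).map_smul a ((orbitEquiv hξ.separating_commutant).symm h : H →L[ℂ] H)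
      rw [map_smul]
      exact congrArg (fun z => z (B c)) this)) ∘ₗ
    (algTensorEquiv K₁ (XiSpace M ξ)).symm.toLinearMap

/-- `B^ξ` acts on simple tensors as it should. -/
theorem ofMatrix_htmul (hξ : IsCyclicSeparating M ξ) (B : K₁ →ₗ[ℂ] HTensor K₂ H) (c : K₁)
    {x : H →L[ℂ] H} (hx : x ∈ M.commutant) :
    ofMatrix hξ B ⟨htmul c (x ξ), htmul_mem_algTensor c (mem_orbit.2 ⟨x, hx, rfl⟩)⟩ =
      amp K₂ x (B c) := by
  have h1 : (algTensorEquiv K₁ (XiSpace M ξ)).symm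
      ⟨htmul c (x ξ), htmul_mem_algTensor c (mem_orbit.2 ⟨x, hx, rfl⟩)⟩ =
      c ⊗ₜ orbitEquiv hξ.separating_commutant ⟨x, hx⟩ := by
    rw [LinearEquiv.symm_apply_eq]; rfl
  simp only [ofMatrix, LinearMap.comp_apply, LinearEquiv.coe_coe, h1, TensorProduct.lift.tmul,
    LinearMap.mk₂_apply, LinearEquiv.symm_apply_apply]

section Spaces

variable (M ξ) (K₁ K₂)

/-- The affiliated operators from `K₁ ⊗ H` to `K₂ ⊗ H` with domain the linear tensor product of
`K₁` and `Ξ`. -/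
def OpM : Set (algTensor K₁ (XiSpace M ξ) →ₗ[ℂ] HTensor K₂ H) :=
  OpAff M (amp K₁) (amp K₂) (algTensor K₁ (XiSpace M ξ))

/-- Those of them whose adjoint is defined on the linear tensor product of `K₂` and `Ξ`. -/
def OpDagM : Set (algTensor K₁ (XiSpace M ξ) →ₗ[ℂ] HTensor K₂ H) :=
  OpDagAff M (amp K₁) (amp K₂) (algTensor K₁ (XiSpace M ξ)) (algTensor K₂ (XiSpace M ξ))

/-- `T†`, the restriction of the adjoint of `T` to the linear tensor product of `K₂` and `Ξ`. -/
abbrev dagM {M : VonNeumannAlgebra H} {ξ : H} {K₁ K₂ : Type*}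
    [NormedAddCommGroup K₁] [InnerProductSpace ℂ K₁]
    [NormedAddCommGroup K₂] [InnerProductSpace ℂ K₂]
    (T : algTensor K₁ (XiSpace M ξ) →ₗ[ℂ] HTensor K₂ H) :
    algTensor K₂ (XiSpace M ξ) →ₗ[ℂ] HTensor K₁ H :=
  dag (algTensor K₂ (XiSpace M ξ)) T

/-- The matrix space associated to `(M, ξ)`: the operators `T` in `OpM` for which `T E_ξ` is
Hilbert–Schmidt. -/
def matrixSpace : Set (algTensor K₁ (XiSpace M ξ) →ₗ[ℂ] HTensor K₂ H) :=
  {T | T ∈ OpM M ξ K₁ K₂ ∧ IsHilbertSchmidt (onXi T)}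

/-- The adjointable matrix space associated to `(M, ξ)`. -/
def adjMatrixSpace : Set (algTensor K₁ (XiSpace M ξ) →ₗ[ℂ] HTensor K₂ H) :=
  {T | T ∈ matrixSpace M ξ K₁ K₂ ∩ OpDagM M ξ K₁ K₂ ∧ dagM T ∈ matrixSpace M ξ K₂ K₁}

/-- The bounded operators `B : K₁ → K₂ ⊗ H` which are Hilbert–Schmidt and for which there is a
Hilbert–Schmidt operator `B_† : K₂ → K₁ ⊗ H` with
`B* (I ⊗ x') E_ξ = E_ξ* (I ⊗ x') B_†` for all `x' ∈ M'`.
(There is at most one such `B_†`.) -/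
def HSDag [CompleteSpace K₁] [CompleteSpace K₂] : Set (K₁ →L[ℂ] HTensor K₂ H) :=
  {B | IsHilbertSchmidt (B : K₁ →ₗ[ℂ] HTensor K₂ H) ∧
    ∃ B' : K₂ →L[ℂ] HTensor K₁ H, IsHilbertSchmidt (B' : K₂ →ₗ[ℂ] HTensor K₁ H) ∧
      ∀ x' ∈ M.commutant,
        ContinuousLinearMap.adjoint B ∘L amp K₂ x' ∘L ketAmp K₂ ξ =
          ContinuousLinearMap.adjoint (ketAmp K₁ ξ) ∘L amp K₁ x' ∘L B'}

/-- The linear span of the operators `A ⊗ X`, with `A : K₁ → K₂` Hilbert–Schmidt and `X` an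
affiliated operator on `H` with domain `Ξ` whose adjoint is defined on `Ξ`. -/
def HSTensorOp :
    Submodule ℂ (algTensor K₁ (XiSpace M ξ) →ₗ[ℂ] HTensor K₂ H) :=
  Submodule.span ℂ {T | ∃ A : K₁ →L[ℂ] K₂, IsHilbertSchmidt (A : K₁ →ₗ[ℂ] K₂) ∧
    ∃ X ∈ OpDagAff M id id (XiSpace M ξ) (XiSpace M ξ), T = tensorOp A X}

end Spaces

/-- The matrix transpose `T^⊤ = ((T E_ξ)_⊤)^ξ` of an element of the matrix space. -/
def matTranspose [CompleteSpace K₁] (hξ : IsCyclicSeparating M ξ) (k₁ : HilbertConj K₁)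
    (k₂ : HilbertConj K₂) (T : algTensor K₁ (XiSpace M ξ) →ₗ[ℂ] HTensor K₂ H) :
    algTensor K₂ (XiSpace M ξ) →ₗ[ℂ] HTensor K₁ H :=
  ofMatrix hξ (partialTranspose k₁ k₂ (onXi T) : K₂ →ₗ[ℂ] HTensor K₁ H)

section ColRow

variable {K : Type*} [NormedAddCommGroup K] [InnerProductSpace ℂ K]

/-- An operator defined on the linear tensor product of `ℂ` and `Ξ`, viewed as one defined on `Ξ`
through the identification `ℂ ⊗ H = H`, `1 ⊗ v = v`. -/
def asCol (C : algTensor ℂ (XiSpace M ξ) →ₗ[ℂ] HTensor K H) : XiSpace M ξ →ₗ[ℂ] HTensor K H :=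
  C ∘ₗ ((leftTensor H (1 : ℂ)).toLinearMap ∘ₗ (XiSpace M ξ).subtype).codRestrict _
    fun v => htmul_mem_algTensor 1 v.2

/-- An operator with values in `H`, viewed as one with values in `ℂ ⊗ H` through the
identification `ℂ ⊗ H = H`. -/
def toRow (R : algTensor K (XiSpace M ξ) →ₗ[ℂ] H) :
    algTensor K (XiSpace M ξ) →ₗ[ℂ] HTensor ℂ H :=
  (leftTensor H (1 : ℂ)).toLinearMap ∘ₗ R

variable (M ξ K)

/-- The adjointable column space: the adjointable matrix space for `ℂ` and `K`, viewed as a space of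
operators from `H` to `K ⊗ H` with domain `Ξ`. -/
def adjColSpace : Set (XiSpace M ξ →ₗ[ℂ] HTensor K H) := asCol '' adjMatrixSpace M ξ ℂ K

/-- The adjointable row space: the adjointable matrix space for `K` and `ℂ`, viewed as a space of
operators from `K ⊗ H` to `H`. -/
def adjRowSpace : Set (algTensor K (XiSpace M ξ) →ₗ[ℂ] H) := toRow ⁻¹' adjMatrixSpace M ξ K ℂ

/-- The value `X ξ`, for an operator `X` with domain `Ξ`. -/
def valXi {M : VonNeumannAlgebra H} {ξ : H} {G : Type*} [AddCommGroup G] [Module ℂ G]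
    (X : XiSpace M ξ →ₗ[ℂ] G) : G := X ⟨ξ, self_mem_orbit M.commutant ξ⟩

/-- The operator `|ζ⟩ : z ↦ z ζ` from `ℂ` to a Hilbert space. -/
abbrev ket {G : Type*} [AddCommGroup G] [Module ℂ G] (ζ : G) : ℂ →ₗ[ℂ] G :=
  LinearMap.toSpanSingleton ℂ G ζ

end ColRow

end Matrix

end AdjointableMatrix

end

open AdjointableMatrix

/-! An affiliated `T` intertwines the actions of `M'`, so `T (c ⊗ x'ξ) = (I ⊗ x') T (c ⊗ ξ)`: it is
determined by its matrix `B = T E_ξ`, and every linear `B` yields an affiliated `B^ξ`. Moving `x'`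
across inner products, `B^ξ` and `B'^ξ` are formally adjoint exactly when `⟪B c₁, c₂ ⊗ x'ξ⟫ = ⟪c₁ ⊗
x'*ξ, B' c₂⟫` for all `x' ∈ M'`, the relation `DagPair`. As the domains are dense, the adjointable
matrix space is described by pairs of Hilbert–Schmidt operators in this relation
(`mem_adjMatrixSpace_iff`). The adjoint swaps the pair; the transpose replaces both members by their
partial transposes, which remain Hilbert–Schmidt because their coefficients are a rearrangement. The
algebraic statements follow from this.

The analytic content is the link with `S_ξ`. If `C` is the partial transpose of `B'`, the relation
says that `(B (k₁ c), C c)` satisfies the identity defining the adjoint of `c ⊗ x'ξ ↦ k c ⊗ x'*ξ`.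
What is needed is Tomita's theorem that `S_ξ` is the whole adjoint of `F : x'ξ ↦ x'*ξ`
(`mem_graphClosure_tomitaCore`); only one inclusion is immediate. Splitting a graph point into two
fixed vectors of `F*`, it is enough that each such vector lies in the closure of `M_sa ξ`. Its
residual `η` after real-orthogonal projection onto that closure is again fixed by `F*`. It vanishes
(`eq_zero_of_real_orthogonal`): the projection onto the closure of the graph of `x'ξ ↦ x'η` is a 2×2
matrix with entries in `M`, on which positivity and the separating property of `ξ` can be used. An
expansion along an orthonormal basis of `K` carries the result from `S_ξ` to `k ⊗ S_ξ`. -/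

namespace AdjointableMatrix

open ContinuousLinearMap (adjoint)
open scoped ENNReal

/-! ### Hilbert–Schmidt operators: independence of the basis, stability. -/

section HilbertSchmidt

variable {E F G : Type*} [NormedAddCommGroup E] [InnerProductSpace ℂ E]
  [NormedAddCommGroup F] [InnerProductSpace ℂ F]
  [NormedAddCommGroup G] [InnerProductSpace ℂ G]

theorem enorm_sq_eq_ofReal {V : Type*} [NormedAddCommGroup V] (v : V) :
    ‖v‖ₑ ^ 2 = ENNReal.ofReal (‖v‖ ^ 2) := by
  rw [← ofReal_norm, ENNReal.ofReal_pow (norm_nonneg _)]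

/-- Parseval with values in `[0, ∞]`, where double sums may be interchanged without summability
hypotheses. -/
theorem tsum_enorm_inner_sq {ι : Type*} (b : HilbertBasis ι ℂ E) (x : E) :
    ∑' i, ‖inner ℂ (b i) x‖ₑ ^ 2 = ‖x‖ₑ ^ 2 := by
  have h := Complex.hasSum_re (b.hasSum_inner_mul_inner x x)
  have h1 : ∀ i,
      Complex.re (inner ℂ x (b i) * inner ℂ (b i) x) = ‖inner ℂ (b i) x‖ ^ 2 := fun i => by
    rw [← inner_conj_symm, ← Complex.normSq_eq_conj_mul_self, Complex.ofReal_re,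
      Complex.normSq_eq_norm_sq]
  have h2 : (inner ℂ x x).re = ‖x‖ ^ 2 := by
    rw [inner_self_eq_norm_sq_to_K]; norm_cast
  rw [h2, funext h1] at h
  simp only [enorm_sq_eq_ofReal]
  rw [← h.tsum_eq, ENNReal.ofReal_tsum_of_nonneg (fun i => by positivity) h.summable]

/-- Both sides are the double sum of `|⟪f j, B (b i)⟫|²`. The left side does not involve `b` and the
right side does not involve `f`, which is why the Hilbert–Schmidt norm is independent of the basis.
-/
theorem tsum_enorm_adjoint_sq [CompleteSpace E] [CompleteSpace F] {ι κ : Type*}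
    (b : HilbertBasis ι ℂ E) (f : HilbertBasis κ ℂ F) (B : E →L[ℂ] F) :
    ∑' j, ‖adjoint B (f j)‖ₑ ^ 2 = ∑' i, ‖B (b i)‖ₑ ^ 2 := by
  simp only [← tsum_enorm_inner_sq b, ← tsum_enorm_inner_sq f]
  rw [ENNReal.tsum_comm]
  refine tsum_congr fun i => tsum_congr fun j => ?_
  rw [ContinuousLinearMap.adjoint_inner_right, ← inner_conj_symm, RCLike.enorm_conj]

theorem eq_zero_of_forall_inner_basis {ι : Type*} (b : HilbertBasis ι ℂ E) {x : E}
    (h : ∀ i, inner ℂ (b i) x = 0) : x = 0 := by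
  have := tsum_enorm_inner_sq b x
  simpa [h] using this.symm

theorem summable_norm_sq_iff {ι V : Type*} [NormedAddCommGroup V] (f : ι → V) :
    Summable (fun i => ‖f i‖ ^ 2) ↔ ∑' i, ‖f i‖ₑ ^ 2 ≠ ∞ := by
  have h : ∀ i, ‖f i‖ₑ ^ 2 = ((‖f i‖₊ ^ 2 : NNReal) : ℝ≥0∞) := fun i => by
    rw [ENNReal.coe_pow]; rfl
  simp only [h]
  rw [ENNReal.tsum_coe_ne_top_iff_summable, ← NNReal.summable_coe]
  simp

/-- The Hilbert–Schmidt property may be tested on any orthonormal basis. -/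
theorem isHilbertSchmidt_iff [CompleteSpace E] [CompleteSpace F] {ι : Type*}
    (b : HilbertBasis ι ℂ E) (B : E →L[ℂ] F) :
    IsHilbertSchmidt (B : E →ₗ[ℂ] F) ↔ ∑' i, ‖B (b i)‖ₑ ^ 2 ≠ ∞ := by
  obtain ⟨w, f, -⟩ := exists_hilbertBasis ℂ F
  constructor
  · rintro ⟨-, s, b', hb'⟩
    rw [← tsum_enorm_adjoint_sq b f, tsum_enorm_adjoint_sq b' f]
    exact (summable_norm_sq_iff _).1 hb'
  · intro h
    obtain ⟨s, b', -⟩ := exists_hilbertBasis ℂ E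
    refine ⟨B.continuous, s, b', (summable_norm_sq_iff _).2 ?_⟩
    rw [← tsum_enorm_adjoint_sq b f, tsum_enorm_adjoint_sq b' f] at h
    exact h

/-- A Hilbert–Schmidt operator, as a bounded operator. -/
def IsHilbertSchmidt.toCLM {B : E →ₗ[ℂ] F} (hB : IsHilbertSchmidt B) : E →L[ℂ] F := ⟨B, hB.1⟩

/-- An operator dominated by a Hilbert–Schmidt operator is Hilbert–Schmidt. -/
theorem IsHilbertSchmidt.of_norm_le {B : E →ₗ[ℂ] F} (hB : IsHilbertSchmidt B)
    {A : E →ₗ[ℂ] G} (C : ℝ) (h : ∀ x, ‖A x‖ ≤ C * ‖B x‖) : IsHilbertSchmidt A := by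
  obtain ⟨hc, s, b, hs⟩ := hB
  refine ⟨?_, s, b, ?_⟩
  -- The absolute value is there because `C` is not assumed nonnegative.
  · have : ∀ x, ‖A x‖ ≤ (|C| * ‖(⟨B, hc⟩ : E →L[ℂ] F)‖) * ‖x‖ := fun x => by
      refine (h x).trans ?_
      rw [mul_assoc]
      exact mul_le_mul (le_abs_self C) ((⟨B, hc⟩ : E →L[ℂ] F).le_opNorm x) (norm_nonneg _)
        (abs_nonneg _)
    exact (A.mkContinuous _ this).continuous
  · refine Summable.of_nonneg_of_le (fun i => by positivity) (fun i => ?_) (hs.mul_left (C ^ 2))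
    rw [← mul_pow]
    exact pow_le_pow_left₀ (norm_nonneg _) (h _) 2

theorem IsHilbertSchmidt.smul {B : E →ₗ[ℂ] F} (hB : IsHilbertSchmidt B) (a : ℂ) :
    IsHilbertSchmidt (a • B) :=
  hB.of_norm_le ‖a‖ fun x => by rw [LinearMap.smul_apply, norm_smul]

theorem IsHilbertSchmidt.clm_comp {B : E →ₗ[ℂ] F} (hB : IsHilbertSchmidt B)
    (A : F →L[ℂ] G) : IsHilbertSchmidt ((A : F →ₗ[ℂ] G) ∘ₗ B) :=
  hB.of_norm_le ‖A‖ fun x => A.le_opNorm (B x)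

/-- Every linear map on `ℂ` is Hilbert–Schmidt. -/
theorem isHilbertSchmidt_of_complex (B : ℂ →ₗ[ℂ] E) : IsHilbertSchmidt B := by
  obtain ⟨w, b, -⟩ := exists_hilbertBasis ℂ ℂ
  have : Finite w := b.orthonormal.linearIndependent.finite
  exact ⟨B.continuous_of_finiteDimensional, w, b, Summable.of_finite⟩

variable [CompleteSpace E] [CompleteSpace F]

theorem IsHilbertSchmidt.zero : IsHilbertSchmidt (0 : E →ₗ[ℂ] F) := by
  obtain ⟨s, b, -⟩ := exists_hilbertBasis ℂ E
  exact (isHilbertSchmidt_iff b (0 : E →L[ℂ] F)).2 (by simp)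

theorem IsHilbertSchmidt.adjoint {B : E →L[ℂ] F} (hB : IsHilbertSchmidt (B : E →ₗ[ℂ] F)) :
    IsHilbertSchmidt (adjoint B : F →ₗ[ℂ] E) := by
  obtain ⟨s, b, -⟩ := exists_hilbertBasis ℂ E
  obtain ⟨t, f, -⟩ := exists_hilbertBasis ℂ F
  rw [isHilbertSchmidt_iff f, tsum_enorm_adjoint_sq b f]
  exact (isHilbertSchmidt_iff b B).1 hB

theorem IsHilbertSchmidt.add {A B : E →ₗ[ℂ] F} (hA : IsHilbertSchmidt A)
    (hB : IsHilbertSchmidt B) : IsHilbertSchmidt (A + B) := by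
  obtain ⟨s, b, -⟩ := exists_hilbertBasis ℂ E
  have h1 := (summable_norm_sq_iff _).2 ((isHilbertSchmidt_iff b hA.toCLM).1 hA)
  have h2 := (summable_norm_sq_iff _).2 ((isHilbertSchmidt_iff b hB.toCLM).1 hB)
  refine ⟨hA.1.add hB.1, s, b, Summable.of_nonneg_of_le (fun i => by positivity) (fun i => ?_)
    ((h1.add h2).mul_left 2)⟩
  change ‖A (b i) + B (b i)‖ ^ 2 ≤ 2 * (‖A (b i)‖ ^ 2 + ‖B (b i)‖ ^ 2)
  calc ‖A (b i) + B (b i)‖ ^ 2 ≤ (‖A (b i)‖ + ‖B (b i)‖) ^ 2 :=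
        pow_le_pow_left₀ (norm_nonneg _) (norm_add_le _ _) 2
    _ ≤ _ := add_sq_le

end HilbertSchmidt

/-! ### Conjugations and orthonormal bases. -/

section Conj

variable {K : Type*} [NormedAddCommGroup K] [InnerProductSpace ℂ K]

theorem HilbertConj.orthonormal (k : HilbertConj K) {ι : Type*} {b : ι → K}
    (hb : Orthonormal ℂ b) : Orthonormal ℂ fun i => k (b i) :=
  ⟨fun i => by rw [k.toEquiv.norm_map]; exact hb.1 i,
    fun i j hij => by
      change inner ℂ (k (b i)) (k (b j)) = 0
      rw [antiunitary_inner]; exact hb.2 hij.symm⟩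

variable [CompleteSpace K]

/-- The image of an orthonormal basis under a conjugation. -/
noncomputable def HilbertConj.basis (k : HilbertConj K) {ι : Type*} (b : HilbertBasis ι ℂ K) :
    HilbertBasis ι ℂ K :=
  HilbertBasis.mkOfOrthogonalEqBot (v := fun i => k (b i))
    (k.orthonormal b.orthonormal) (by
    rw [Submodule.eq_bot_iff]
    intro x hx
    have h0 : k x = 0 := eq_zero_of_forall_inner_basis b fun i => by
      rw [← k.involutive (b i), antiunitary_inner, ← inner_conj_symm,
        (Submodule.mem_orthogonal _ _).1 hx _ (Submodule.subset_span ⟨i, rfl⟩), map_zero]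
    simpa using h0)

@[simp] theorem HilbertConj.basis_apply (k : HilbertConj K) {ι : Type*} (b : HilbertBasis ι ℂ K)
    (i : ι) : k.basis b i = k (b i) := by
  rw [HilbertConj.basis, HilbertBasis.coe_mkOfOrthogonalEqBot]

end Conj

/-! ### Slices and orthonormal bases of `K ⊗ H`. -/

section TensorBasis

variable {K H : Type*} [NormedAddCommGroup K] [InnerProductSpace ℂ K]
  [NormedAddCommGroup H] [InnerProductSpace ℂ H]

theorem orthonormal_htmul {ι κ : Type*} {b : ι → K} {f : κ → H} (hb : Orthonormal ℂ b)
    (hf : Orthonormal ℂ f) : Orthonormal ℂ fun p : ι × κ => htmul (b p.1) (f p.2) :=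
  ⟨fun p => by
      change ‖htmul (b p.1) (f p.2)‖ = 1
      rw [htmul, UniformSpace.Completion.norm_coe, TensorProduct.norm_tmul, hb.1,
        hf.1, one_mul],
    fun p q hpq => by
      change inner ℂ (htmul (b p.1) (f p.2)) (htmul (b q.1) (f q.2)) = 0
      rw [inner_htmul]
      by_cases h : p.1 = q.1
      · rw [hf.2 fun h' => hpq (Prod.ext h h'), mul_zero]
      · rw [hb.2 h, zero_mul]⟩

variable [CompleteSpace H]

/-- The adjoint of `v ↦ c ⊗ v` contracts the first leg against `c`; it serves throughout as the
`H`-valued coordinate of `w` along `c`. -/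
theorem inner_adjoint_leftTensor (c : K) (v : H) (w : HTensor K H) :
    inner ℂ v (adjoint (leftTensor H c) w) = inner ℂ (htmul c v) w := by
  rw [ContinuousLinearMap.adjoint_inner_right]; rfl

variable [CompleteSpace K]

/-- The orthonormal basis `b i ⊗ f j` of `K ⊗ H`. -/
noncomputable def htensorBasis {ι κ : Type*} (b : HilbertBasis ι ℂ K) (f : HilbertBasis κ ℂ H) :
    HilbertBasis (ι × κ) ℂ (HTensor K H) :=
  HilbertBasis.mkOfOrthogonalEqBot (v := fun p => htmul (b p.1) (f p.2))
    (orthonormal_htmul b.orthonormal f.orthonormal) (by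
    rw [Submodule.eq_bot_iff]
    intro w hw
    have h0 : ∀ i j, inner ℂ (htmul (b i) (f j)) w = 0 := fun i j =>
      (Submodule.mem_orthogonal _ _).1 hw _ (Submodule.subset_span ⟨(i, j), rfl⟩)
    -- Totality is checked one leg at a time: `f` is exhausted with `b i` fixed, then `b` with an
    -- arbitrary second leg.
    have h1 : ∀ i v, inner ℂ (htmul (b i) v) w = 0 := fun i v => by
      rw [← inner_adjoint_leftTensor, eq_zero_of_forall_inner_basis f (x := adjoint _ w),
        inner_zero_right]
      exact fun j => (inner_adjoint_leftTensor _ _ _).trans (h0 i j)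
    refine htensor_ext_inner fun c v => ?_
    have h2 : adjoint (ketAmp K v) w = 0 := eq_zero_of_forall_inner_basis b fun i => by
      rw [ContinuousLinearMap.adjoint_inner_right]; exact h1 i v
    rw [inner_zero_right, ← ketAmp_apply, ← ContinuousLinearMap.adjoint_inner_right, h2,
      inner_zero_right])

@[simp] theorem htensorBasis_apply {ι κ : Type*} (b : HilbertBasis ι ℂ K)
    (f : HilbertBasis κ ℂ H) (p : ι × κ) : htensorBasis b f p = htmul (b p.1) (f p.2) := by
  rw [htensorBasis, HilbertBasis.coe_mkOfOrthogonalEqBot]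

/-- The expansion of a vector of `K ⊗ H` along an orthonormal basis of `K`. -/
theorem hasSum_htmul_adjoint {ι : Type*} (b : HilbertBasis ι ℂ K) (w : HTensor K H) :
    HasSum (fun i => htmul (b i) (adjoint (leftTensor H (b i)) w)) w := by
  obtain ⟨s, f, -⟩ := exists_hilbertBasis ℂ H
  -- The Fourier series over the product basis is grouped by `i`; each row sums to `b i` tensored
  -- with the slice of `w` along `b i`.
  refine ((htensorBasis b f).hasSum_repr w).prod_fiberwise fun i => ?_
  rw [← leftTensor_apply]
  convert (f.hasSum_repr (adjoint (leftTensor H (b i)) w)).mapL (leftTensor H (b i)) using 1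
  ext j
  rw [map_smul, leftTensor_apply, htensorBasis_apply, HilbertBasis.repr_apply_apply,
    HilbertBasis.repr_apply_apply, inner_adjoint_leftTensor, htensorBasis_apply]

end TensorBasis

/-! ### Tomita's theorem: `S_ξ` is the adjoint of `x'ξ ↦ x'*ξ`. -/

section TomitaAdjoint

variable {H : Type*} [NormedAddCommGroup H] [InnerProductSpace ℂ H] [CompleteSpace H]
  {M : VonNeumannAlgebra H} {ξ : H}

theorem mem_of_forall_commute {x : H →L[ℂ] H}
    (h : ∀ y ∈ M.commutant, ∀ v, x (y v) = y (x v)) : x ∈ M := by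
  rw [← M.commutant_commutant, VonNeumannAlgebra.mem_commutant_iff]
  intro y hy
  ext v
  exact (h y hy v).symm

/-- The closed linear span of the vectors `(x' ξ, x' η)` with `x' ∈ M'`. -/
noncomputable def diagOrbit (M : VonNeumannAlgebra H) (ξ η : H) :
    Submodule ℂ (WithLp 2 (H × H)) :=
  (LinearMap.range ((WithLp.linearEquiv 2 ℂ (H × H)).symm.toLinearMap ∘ₗ
    (evalAt M.commutant ξ).prod (evalAt M.commutant η))).topologicalClosure

theorem mem_diagOrbit (ξ η : H) {x : H →L[ℂ] H} (hx : x ∈ M.commutant) :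
    WithLp.toLp 2 (x ξ, x η) ∈ diagOrbit M ξ η :=
  Submodule.le_topologicalClosure _ ⟨⟨x, hx⟩, rfl⟩

instance (ξ η : H) : CompleteSpace (diagOrbit M ξ η) :=
  (Submodule.isClosed_topologicalClosure _).completeSpace_coe

theorem mem_diagOrbit_orthogonal {ξ η : H} {w : WithLp 2 (H × H)} :
    w ∈ (diagOrbit M ξ η)ᗮ ↔
      ∀ x ∈ M.commutant, inner ℂ (x ξ) w.fst + inner ℂ (x η) w.snd = 0 := by
  rw [diagOrbit, Submodule.orthogonal_closure, Submodule.mem_orthogonal]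
  constructor
  · intro h x hx
    exact h _ ⟨⟨x, hx⟩, rfl⟩
  · rintro h _ ⟨x, rfl⟩
    exact h x x.2

/-- The diagonal action of an operator on `H ⊕ H`. -/
noncomputable def diagOp (y : H →L[ℂ] H) : WithLp 2 (H × H) →L[ℂ] WithLp 2 (H × H) :=
  (WithLp.prodContinuousLinearEquiv 2 ℂ H H).symm.toContinuousLinearMap ∘L (y.prodMap y) ∘L
    (WithLp.prodContinuousLinearEquiv 2 ℂ H H).toContinuousLinearMap

theorem diagOp_mem_diagOrbit {ξ η : H} {y : H →L[ℂ] H} (hy : y ∈ M.commutant)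
    {w : WithLp 2 (H × H)} (hw : w ∈ diagOrbit M ξ η) : diagOp y w ∈ diagOrbit M ξ η := by
  refine map_mem_closure (f := diagOp y) (diagOp y).continuous hw ?_
  rintro _ ⟨x, rfl⟩
  exact ⟨⟨y * x, mul_mem hy x.2⟩, rfl⟩

/-- The subspace is invariant under `M'`, and so is its orthogonal complement because `M'` is closed
under `*`. By the bicommutant theorem the matrix entries of the projection then lie in `M`. -/
theorem starProjection_diagOrbit_diagOp (ξ η : H) {y : H →L[ℂ] H} (hy : y ∈ M.commutant)
    (w : WithLp 2 (H × H)) :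
    (diagOrbit M ξ η).starProjection (diagOp y w) =
      diagOp y ((diagOrbit M ξ η).starProjection w) := by
  apply Submodule.eq_starProjection_of_mem_orthogonal
  · exact diagOp_mem_diagOrbit hy (Submodule.starProjection_apply_mem _ _)
  · rw [← map_sub, mem_diagOrbit_orthogonal]
    intro x hx
    have := mem_diagOrbit_orthogonal.1
      (Submodule.sub_starProjection_mem_orthogonal (K := diagOrbit M ξ η) w) _
      (mul_mem (star_mem hy) hx)
    simpa [diagOp, ContinuousLinearMap.star_eq_adjoint,
      ContinuousLinearMap.adjoint_inner_left] using this

/-- A vector which is orthogonal, for the real inner product, to `M_sa ξ` and `i M'_sa ξ`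
vanishes. -/
theorem eq_zero_of_real_orthogonal (hξ : IsCyclicSeparating M ξ) {η : H}
    (h1 : ∀ x ∈ M.commutant, inner ℂ (x ξ) η = inner ℂ η (star x ξ))
    (h2 : ∀ x ∈ M, (inner ℂ η ((x + star x) ξ)).re = 0) : η = 0 := by
  -- Below, `p` is read as a 2×2 matrix with entries `pᵢⱼ = πᵢ p ιⱼ`. Heuristically it is the
  -- characteristic projection of the operator `x'ξ ↦ x'η` affiliated to `M`.
  set p := (diagOrbit M ξ η).starProjection with hp
  let π₁ := WithLp.fstL 2 ℂ H H
  let π₂ := WithLp.sndL 2 ℂ H H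
  let ι₁ : H →L[ℂ] WithLp 2 (H × H) :=
    (WithLp.prodContinuousLinearEquiv 2 ℂ H H).symm.toContinuousLinearMap ∘L
      ContinuousLinearMap.inl ℂ H H
  let ι₂ : H →L[ℂ] WithLp 2 (H × H) :=
    (WithLp.prodContinuousLinearEquiv 2 ℂ H H).symm.toContinuousLinearMap ∘L
      ContinuousLinearMap.inr ℂ H H
  have hι₁ : ∀ y v, ι₁ (y v) = diagOp y (ι₁ v) := fun y v => by simp [ι₁, diagOp]
  have hι₂ : ∀ y v, ι₂ (y v) = diagOp y (ι₂ v) := fun y v => by simp [ι₂, diagOp]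
  have hi₁ : ∀ v w, inner ℂ (ι₁ v) w = inner ℂ v (π₁ w) := fun v w => by
    simp [ι₁, π₁, WithLp.prod_inner_apply]
  have hi₂ : ∀ v w, inner ℂ (ι₂ v) w = inner ℂ v (π₂ w) := fun v w => by
    simp [ι₂, π₂, WithLp.prod_inner_apply]
  have m11 : π₁ ∘L p ∘L ι₁ ∈ M := mem_of_forall_commute fun y hy v => by
    change π₁ (p (ι₁ (y v))) = y (π₁ (p (ι₁ v)))
    rw [hι₁, hp, starProjection_diagOrbit_diagOp _ _ hy]; rfl
  have m12 : π₁ ∘L p ∘L ι₂ ∈ M := mem_of_forall_commute fun y hy v => by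
    change π₁ (p (ι₂ (y v))) = y (π₁ (p (ι₂ v)))
    rw [hι₂, hp, starProjection_diagOrbit_diagOp _ _ hy]; rfl
  have hps : ∀ v w, inner ℂ (p v) w = inner ℂ v (p w) :=
    fun v w => Submodule.inner_starProjection_left_eq_right _ v w
  have hstar : star (π₁ ∘L p ∘L ι₂) = π₂ ∘L p ∘L ι₁ := by
    rw [ContinuousLinearMap.star_eq_adjoint]
    symm
    rw [ContinuousLinearMap.eq_adjoint_iff]
    intro v w
    change inner ℂ (π₂ (p (ι₁ v))) w = inner ℂ v (π₁ (p (ι₂ w)))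
    rw [← inner_conj_symm, ← hi₂, inner_conj_symm, hps, hi₁]
  have a1 : p (ι₁ ξ) + p (ι₂ η) = ι₁ ξ + ι₂ η := by
    rw [← map_add, hp, Submodule.starProjection_eq_self_iff]
    convert mem_diagOrbit (M := M) ξ η (one_mem _) using 1
    simp [ι₁, ι₂, ← WithLp.toLp_add]
  -- The hypothesis `h1` says precisely that `(η, -ξ)` is orthogonal to every `(x'ξ, x'η)`, as for
  -- the graph of a symmetric operator. First coordinates give `p₁₁ η = p₁₂ ξ`.
  have a2 : p (ι₁ η) - p (ι₂ ξ) = 0 := by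
    rw [← map_sub, hp, Submodule.starProjection_apply_eq_zero_iff, mem_diagOrbit_orthogonal]
    intro x hx
    have := h1 x hx
    simp only [ι₁, ι₂]
    simp [this, ContinuousLinearMap.star_eq_adjoint, ContinuousLinearMap.adjoint_inner_right]
  have b11 : π₁ (p (ι₁ ξ)) + π₁ (p (ι₂ η)) = ξ := by
    rw [← map_add, a1]; simp [π₁, ι₁, ι₂]
  have b21 : π₂ (p (ι₁ ξ)) + π₂ (p (ι₂ η)) = η := by
    rw [← map_add, a1]; simp [π₂, ι₁, ι₂]
  -- Real orthogonality is tested on `p₁₂ + p₁₂* = p₁₂ + p₂₁`. Since `p₁₂ ξ = p₁₁ η` and `p₂₁ ξ = η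
  -- - p₂₂ η`, it becomes the vanishing of a sum of two nonnegative numbers.
  have a3 := h2 _ m12
  rw [hstar] at a3
  change (inner ℂ η (π₁ (p (ι₂ ξ)) + π₂ (p (ι₁ ξ)))).re = 0 at a3
  rw [← sub_eq_zero.1 a2, eq_sub_of_add_eq b21] at a3
  have c1 : (inner ℂ η (π₁ (p (ι₁ η)))).re = ‖p (ι₁ η)‖ ^ 2 := by
    rw [← hi₁, ← inner_conj_symm, Complex.conj_re]
    exact Submodule.re_inner_starProjection_eq_normSq (diagOrbit M ξ η) (ι₁ η)
  have c2 : 0 ≤ (inner ℂ η (η - π₂ (p (ι₂ η)))).re := by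
    have e1 : η - π₂ (p (ι₂ η)) = π₂ (ι₂ η - p (ι₂ η)) := by simp [π₂, ι₂]
    have e2 : (inner ℂ (ι₂ η) (p (ι₂ η))).re = ‖p (ι₂ η)‖ ^ 2 := by
      rw [← inner_conj_symm, Complex.conj_re]
      exact Submodule.re_inner_starProjection_eq_normSq (diagOrbit M ξ η) (ι₂ η)
    have e3 : (inner ℂ (ι₂ η) (ι₂ η)).re = ‖ι₂ η‖ ^ 2 := by
      rw [inner_self_eq_norm_sq_to_K]; norm_cast
    rw [e1, ← hi₂, inner_sub_right, Complex.sub_re, e2, e3, sub_nonneg]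
    exact pow_le_pow_left₀ (norm_nonneg _) (Submodule.norm_starProjection_apply_le _ _) 2
  rw [inner_add_right, Complex.add_re, c1] at a3
  have d1 : p (ι₁ η) = 0 := by
    rw [← norm_eq_zero, ← sq_eq_zero_iff]
    exact le_antisymm (by linarith) (sq_nonneg _)
  -- Now `p₁₂ ξ = p₁₁ η = 0`, so `p₁₂ = 0` as `ξ` separates `M`. Then `p₁₁ ξ = ξ` forces `p₁₁ = 1`,
  -- whence `η = p₁₁ η = 0`.
  have e12 : π₁ ∘L p ∘L ι₂ = 0 := hξ.separating _ m12 (by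
    change π₁ (p (ι₂ ξ)) = 0
    rw [← sub_eq_zero.1 a2, d1, map_zero])
  have e11 : 1 - π₁ ∘L p ∘L ι₁ = 0 := hξ.separating _ (sub_mem (one_mem _) m11) (by
    change ξ - π₁ (p (ι₁ ξ)) = 0
    have : π₁ (p (ι₂ η)) = 0 := congrArg (fun z : H →L[ℂ] H => z η) e12
    rw [this, add_zero] at b11
    rw [b11, sub_self])
  have := congrArg (fun z : H →L[ℂ] H => z η) e11
  change η - π₁ (p (ι₁ η)) = 0 at this
  rwa [d1, map_zero, sub_zero] at this

/-- The real subspace `M_sa ξ`. -/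
noncomputable def selfAdjointOrbit (M : VonNeumannAlgebra H) (ξ : H) : Submodule ℝ H where
  carrier := {h | ∃ x ∈ M, star x = x ∧ x ξ = h}
  add_mem' := by
    rintro _ _ ⟨x, hx, hx', rfl⟩ ⟨y, hy, hy', rfl⟩
    exact ⟨x + y, add_mem hx hy, by rw [star_add, hx', hy'], rfl⟩
  zero_mem' := ⟨0, zero_mem M, star_zero _, rfl⟩
  smul_mem' := by
    rintro r _ ⟨x, hx, hx', rfl⟩
    refine ⟨(r : ℂ) • x, M.toStarSubalgebra.smul_mem hx r, by rw [star_smul, hx']; simp, by simp⟩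

theorem tomitaCore_apply (hξ : IsCyclicSeparating M ξ) {x : H →L[ℂ] H} (hx : x ∈ M) :
    tomitaCore hξ ⟨x ξ, mem_orbit.2 ⟨x, hx, rfl⟩⟩ = star x ξ := by
  have : (orbitEquiv hξ.separating).symm ⟨x ξ, mem_orbit.2 ⟨x, hx, rfl⟩⟩ = ⟨x, hx⟩ := by
    rw [LinearEquiv.symm_apply_eq]; rfl
  change star (((orbitEquiv hξ.separating).symm ⟨x ξ, mem_orbit.2 ⟨x, hx, rfl⟩⟩ :
    M.toStarSubalgebra) : H →L[ℂ] H) ξ = _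
  rw [this]

/-- The hypothesis says that `ζ` is fixed by the adjoint of `x'ξ ↦ x'*ξ`. The core of `S_ξ` fixes
`M_sa ξ` pointwise, so it suffices to place `ζ` in the real closure of `M_sa ξ`. -/
theorem mem_graphClosure_tomitaCore_of_symmetric (hξ : IsCyclicSeparating M ξ) {ζ : H}
    (h : ∀ x ∈ M.commutant, inner ℂ (x ξ) ζ = inner ℂ ζ (star x ξ)) :
    (ζ, ζ) ∈ graphClosure (tomitaCore hξ) := by
  let _ : InnerProductSpace ℝ H := InnerProductSpace.complexToReal
  let P : Submodule ℝ H := (selfAdjointOrbit M ξ).topologicalClosure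
  have : CompleteSpace P := (Submodule.isClosed_topologicalClosure _).completeSpace_coe
  have hP : ∀ q ∈ P, ∀ x ∈ M.commutant, inner ℂ (x ξ) q = inner ℂ q (star x ξ) := by
    intro q hq x hx
    have hc : IsClosed {q : H | inner ℂ (x ξ) q = inner ℂ q (star x ξ)} :=
      isClosed_eq (by fun_prop) (by fun_prop)
    refine closure_minimal ?_ hc hq
    rintro _ ⟨y, hy, hy', rfl⟩
    have := tomitaCore_inner hξ ⟨y ξ, mem_orbit.2 ⟨y, hy, rfl⟩⟩ hx
    rwa [tomitaCore_apply hξ hy, hy'] at this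
  have hproj : ζ ∈ P := by
    -- The residual inherits the symmetry from `ζ` and from its projection (by `hP`), and is
    -- real-orthogonal to each self-adjoint `x + x*` applied to `ξ`.
    have h0 : ζ - P.starProjection ζ = 0 := by
      refine eq_zero_of_real_orthogonal hξ (fun x hx => ?_) fun x hx => ?_
      · rw [inner_sub_left, inner_sub_right, h x hx,
          hP _ (Submodule.starProjection_apply_mem _ _) x hx]
      · have := (Submodule.mem_orthogonal' _ _).1
          (Submodule.sub_starProjection_mem_orthogonal (K := P) ζ) ((x + star x) ξ)
          (Submodule.le_topologicalClosure _ ⟨x + star x, add_mem hx (star_mem hx),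
            by rw [star_add, star_star, add_comm], rfl⟩)
        exact this
    rw [sub_eq_zero] at h0
    rw [h0]
    exact Submodule.starProjection_apply_mem _ _
  refine map_mem_closure (f := fun z : H => (z, z)) (by fun_prop) hproj ?_
  rintro _ ⟨x, hx, hx', rfl⟩
  exact ⟨⟨x ξ, mem_orbit.2 ⟨x, hx, rfl⟩⟩,
    Prod.ext rfl ((tomitaCore_apply hξ hx).trans (by rw [hx']))⟩

/-- The Tomita–Takesaki operator is the adjoint of `x' ξ ↦ x'* ξ`, `x' ∈ M'`. -/
theorem mem_graphClosure_tomitaCore (hξ : IsCyclicSeparating M ξ) {ζ η : H}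
    (h : ∀ x ∈ M.commutant, inner ℂ (x ξ) η = inner ℂ ζ (star x ξ)) :
    (ζ, η) ∈ graphClosure (tomitaCore hξ) := by
  have h' : ∀ x ∈ M.commutant, inner ℂ (x ξ) ζ = inner ℂ η (star x ξ) := fun x hx => by
    rw [← inner_conj_symm, ← inner_conj_symm η, h (star x) (star_mem hx), star_star]
  -- A conjugate-linear involution exchanging `ζ` and `η` fixes `ζ + η` and `i(ζ - η)`. The pair is
  -- recovered as half of the first minus `i` times the second, with the scalar conjugated in the
  -- second coordinate.
  have ha := mem_graphClosure_tomitaCore_of_symmetric hξ (ζ := ζ + η) fun x hx => by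
    rw [inner_add_right, inner_add_left, h x hx, h' x hx, add_comm]
  have hb := mem_graphClosure_tomitaCore_of_symmetric hξ (ζ := Complex.I • (ζ - η))
    fun x hx => by
    rw [inner_smul_right, inner_smul_left, inner_sub_right, inner_sub_left, h x hx, h' x hx,
      Complex.conj_I]
    ring
  have := graphClosure_smul (1 / 2) (graphClosure_add ha (graphClosure_smul (-Complex.I) hb))
  convert this using 1
  refine Prod.ext ?_ ?_
  · simp [smul_smul]
    module
  · simp [smul_smul, Complex.conj_ofNat]
    module

end TomitaAdjoint

/-! ### Affiliation as intertwining with the whole commutant. -/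

section Ampliation

variable {H : Type*} [NormedAddCommGroup H] [InnerProductSpace ℂ H] [CompleteSpace H]
  {F₁ : Type*} [NormedAddCommGroup F₁] [InnerProductSpace ℂ F₁]
  {F₂ : Type*} [NormedAddCommGroup F₂] [InnerProductSpace ℂ F₂]
  {M : VonNeumannAlgebra H}

/-- A linear, unital, multiplicative and `*`-preserving way `a` to let the bounded operators on `H`
act on `F₁`. -/
structure IsAmpliation (a : (H →L[ℂ] H) → F₁ →L[ℂ] F₁) : Prop where
  map_add : ∀ x y, a (x + y) = a x + a y
  map_smul : ∀ (z : ℂ) x, a (z • x) = z • a x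
  map_one : a 1 = 1
  map_mul : ∀ x y, a (x * y) = a x * a y
  inner_left : ∀ x v w, inner ℂ (a x v) w = inner ℂ v (a (star x) w)

theorem isAmpliation_id : IsAmpliation (id : (H →L[ℂ] H) → H →L[ℂ] H) :=
  ⟨fun _ _ => rfl, fun _ _ => rfl, rfl, fun _ _ => rfl, fun x v w => by
    rw [id, id, ContinuousLinearMap.star_eq_adjoint, ContinuousLinearMap.adjoint_inner_right]⟩

theorem isAmpliation_amp (K : Type*) [NormedAddCommGroup K] [InnerProductSpace ℂ K] :
    IsAmpliation (amp K : (H →L[ℂ] H) → HTensor K H →L[ℂ] HTensor K H) where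
  map_add := (ampₗ K H).map_add
  map_smul := (ampₗ K H).map_smul
  map_one := htensor_clm_ext fun c v => by simp
  map_mul x y := htensor_clm_ext fun c v => by simp
  inner_left x v w := by
    have h : adjoint (amp K x) = amp K (star x) := htensor_clm_ext fun c v => by
      refine htensor_ext_inner fun c' v' => ?_
      rw [ContinuousLinearMap.adjoint_inner_right, amp_htmul, amp_htmul, inner_htmul, inner_htmul,
        ContinuousLinearMap.star_eq_adjoint, ContinuousLinearMap.adjoint_inner_right]
    rw [← h, ContinuousLinearMap.adjoint_inner_right]

/-- A von Neumann algebra is spanned by its unitaries. -/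
theorem mem_span_unitary (N : VonNeumannAlgebra H) {x : H →L[ℂ] H} (hx : x ∈ N) :
    x ∈ Submodule.span ℂ {u | u ∈ N ∧ u ∈ unitary (H →L[ℂ] H)} := by
  -- A double commutant is norm closed, so `N` is a C*-algebra, and those are spanned by their
  -- unitaries.
  have hcl : IsClosed (N.toStarSubalgebra : Set (H →L[ℂ] H)) := by
    rw [N.coe_toStarSubalgebra, ← N.centralizer_centralizer]
    exact Set.isClosed_centralizer _
  let _ : CStarAlgebra N.toStarSubalgebra :=
    have : IsClosed (N.toStarSubalgebra : Set (H →L[ℂ] H)) := hcl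
    StarSubalgebra.cstarAlgebra N.toStarSubalgebra
  have h : (⟨x, hx⟩ : N.toStarSubalgebra) ∈
      Submodule.span ℂ (unitary N.toStarSubalgebra : Set N.toStarSubalgebra) := by
    rw [CStarAlgebra.span_unitary]; trivial
  have h2 := Submodule.mem_map_of_mem (f := N.toStarSubalgebra.toSubalgebra.val.toLinearMap) h
  rw [Submodule.map_span] at h2
  refine Submodule.span_mono ?_ h2
  rintro _ ⟨u, hu, rfl⟩
  refine ⟨u.2, ?_⟩
  replace hu : star u * u = 1 ∧ u * star u = 1 := Unitary.mem_iff.1 hu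
  rw [Unitary.mem_iff]
  exact ⟨congrArg Subtype.val hu.1, congrArg Subtype.val hu.2⟩

/-- An operator is affiliated if and only if it intertwines the action of the commutant. -/
theorem mem_OpAff_iff {a₁ : (H →L[ℂ] H) → F₁ →L[ℂ] F₁} {a₂ : (H →L[ℂ] H) → F₂ →L[ℂ] F₂}
    (h₁ : IsAmpliation a₁) (h₂ : IsAmpliation a₂) {D : Submodule ℂ F₁}
    (hD : ∀ x ∈ M.commutant, ∀ v ∈ D, a₁ x v ∈ D) {T : D →ₗ[ℂ] F₂} :
    T ∈ OpAff M a₁ a₂ D ↔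
      ∀ x (hx : x ∈ M.commutant) (v : D), T ⟨a₁ x v, hD x hx v v.2⟩ = a₂ x (T v) := by
  constructor
  · intro hT x hx v
    -- Membership in `D` is made part of the claim, so that the induction over the span of unitaries
    -- need not track that intermediate operators lie in `M'`.
    suffices h : ∃ w : D, (w : F₁) = a₁ x v ∧ T w = a₂ x (T v) by
      obtain ⟨w, hw, hw'⟩ := h
      rw [← hw']
      exact congrArg T (Subtype.ext hw.symm)
    have hx' := mem_span_unitary _ hx
    clear hx
    induction hx' using Submodule.span_induction with
    | mem u hu =>
      have := (hT u hu.1 hu.2 v (T v)).2 ((LinearPMap.mk D T).mem_graph v)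
      obtain ⟨w, hw, hw'⟩ := (LinearPMap.mem_graph_iff _).1 this
      exact ⟨w, hw, hw'⟩
    | zero =>
      refine ⟨0, ?_, ?_⟩
      · have := h₁.map_smul 0 0
        rw [zero_smul, zero_smul] at this
        rw [this]; rfl
      · have := h₂.map_smul 0 0
        rw [zero_smul, zero_smul] at this
        rw [this, map_zero]; rfl
    | add x y hx hy ihx ihy =>
      obtain ⟨w, hw, hw'⟩ := ihx
      obtain ⟨z, hz, hz'⟩ := ihy
      refine ⟨w + z, ?_, ?_⟩
      · rw [h₁.map_add, Submodule.coe_add, hw, hz]; rfl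
      · rw [h₂.map_add, map_add, hw', hz']; rfl
    | smul c x hx ih =>
      obtain ⟨w, hw, hw'⟩ := ih
      refine ⟨c • w, ?_, ?_⟩
      · rw [h₁.map_smul, Submodule.coe_smul, hw]; rfl
      · rw [h₂.map_smul, map_smul, hw']; rfl
  · intro hT u hu hu' x y
    have key : ∀ u ∈ M.commutant, ∀ x y, (x, y) ∈ (LinearPMap.mk D T).graph →
        (a₁ u x, a₂ u y) ∈ (LinearPMap.mk D T).graph := by
      intro u hu x y h
      obtain ⟨w, hw, hw'⟩ := (LinearPMap.mem_graph_iff _).1 h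
      refine (LinearPMap.mem_graph_iff _).2 ⟨⟨a₁ u w, hD u hu w w.2⟩, ?_, ?_⟩
      · exact congrArg (a₁ u) hw
      · exact (hT u hu w).trans (congrArg (a₂ u) hw')
    refine ⟨fun h => ?_, key u hu x y⟩
    have := key (star u) (star_mem hu) _ _ h
    have e₁ : a₁ (star u) (a₁ u x) = x := by
      have := h₁.map_mul (star u) u
      rw [(Unitary.mem_iff.1 hu').1, h₁.map_one] at this
      exact (congrArg (fun z : F₁ →L[ℂ] F₁ => z x) this).symm
    have e₂ : a₂ (star u) (a₂ u y) = y := by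
      have := h₂.map_mul (star u) u
      rw [(Unitary.mem_iff.1 hu').1, h₂.map_one] at this
      exact (congrArg (fun z : F₂ →L[ℂ] F₂ => z y) this).symm
    rwa [e₁, e₂] at this

end Ampliation

/-! ### Formal adjoints on dense domains. -/

section AdjPair

variable {F₁ : Type*} [NormedAddCommGroup F₁] [InnerProductSpace ℂ F₁]
  {F₂ : Type*} [NormedAddCommGroup F₂] [InnerProductSpace ℂ F₂]
  {D₁ : Submodule ℂ F₁} {D₂ : Submodule ℂ F₂} {T : D₁ →ₗ[ℂ] F₂} {T' : D₂ →ₗ[ℂ] F₁}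

/-- `T` and `T'` are formally adjoint to each other. -/
def AdjPair (T : D₁ →ₗ[ℂ] F₂) (T' : D₂ →ₗ[ℂ] F₁) : Prop :=
  ∀ (x : D₁) (y : D₂), inner ℂ (T' y) (x : F₁) = inner ℂ (y : F₂) (T x)

theorem AdjPair.symm (h : AdjPair T T') : AdjPair T' T := fun y x => by
  rw [← inner_conj_symm, ← h x y, inner_conj_symm]

variable [CompleteSpace F₁]

theorem AdjPair.mem_OpDag (h : AdjPair T T') : T ∈ OpDag D₁ D₂ := fun y hy =>
  LinearPMap.mem_adjoint_domain_of_exists y ⟨T' ⟨y, hy⟩, fun x => h x ⟨y, hy⟩⟩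

theorem adjPair_dag (hD : Dense (D₁ : Set F₁)) (hT : T ∈ OpDag D₁ D₂) :
    AdjPair T (dag D₂ T) := fun x y => by
  have hT' : D₂ ≤ (LinearPMap.mk D₁ T).adjoint.domain := hT
  rw [dag, dif_pos hT']
  exact LinearPMap.adjoint_isFormalAdjoint (T := LinearPMap.mk D₁ T) hD ⟨y, hT' y.2⟩ x

/-- A formal adjoint of a densely defined operator is unique on its domain; daggers are therefore
computed by exhibiting one. -/
theorem AdjPair.dag_eq (hD : Dense (D₁ : Set F₁)) (h : AdjPair T T') : dag D₂ T = T' := by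
  ext y
  refine hD.eq_of_inner_left ℂ fun x hx => ?_
  exact (adjPair_dag hD h.mem_OpDag ⟨x, hx⟩ y).trans (h ⟨x, hx⟩ y).symm

end AdjPair

/-! ### Affiliation passes to formal adjoints. -/

section AdjPairAffiliated

variable {F₁ : Type*} [NormedAddCommGroup F₁] [InnerProductSpace ℂ F₁]
  {F₂ : Type*} [NormedAddCommGroup F₂] [InnerProductSpace ℂ F₂]
  {D₁ : Submodule ℂ F₁} {D₂ : Submodule ℂ F₂} {T : D₁ →ₗ[ℂ] F₂} {T' : D₂ →ₗ[ℂ] F₁}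
  {H : Type*} [NormedAddCommGroup H] [InnerProductSpace ℂ H] [CompleteSpace H]
  {M : VonNeumannAlgebra H}

/-- The adjoint of an intertwiner of `*`-actions is an intertwiner; density of `D₁` allows this to
be tested against vectors on which `T` is defined. -/
theorem AdjPair.mem_OpAff {a₁ : (H →L[ℂ] H) → F₁ →L[ℂ] F₁} {a₂ : (H →L[ℂ] H) → F₂ →L[ℂ] F₂}
    (h₁ : IsAmpliation a₁) (h₂ : IsAmpliation a₂)
    (hD₁ : ∀ x ∈ M.commutant, ∀ v ∈ D₁, a₁ x v ∈ D₁)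
    (hD₂ : ∀ x ∈ M.commutant, ∀ v ∈ D₂, a₂ x v ∈ D₂) (hD : Dense (D₁ : Set F₁))
    (h : AdjPair T T') (hT : T ∈ OpAff M a₁ a₂ D₁) : T' ∈ OpAff M a₂ a₁ D₂ := by
  rw [mem_OpAff_iff h₁ h₂ hD₁] at hT
  rw [mem_OpAff_iff h₂ h₁ hD₂]
  intro x hx y
  refine hD.eq_of_inner_left ℂ fun v hv => ?_
  rw [h₁.inner_left]
  refine (h ⟨v, hv⟩ _).trans ?_
  rw [h₂.inner_left, ← hT _ (star_mem hx) ⟨v, hv⟩]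
  exact (h _ y).symm

end AdjPairAffiliated

/-! ### Density of, and extensionality on, linear tensor products. -/

section AlgTensor

variable {H : Type*} [NormedAddCommGroup H] [InnerProductSpace ℂ H]
  {K₁ : Type*} [NormedAddCommGroup K₁] [InnerProductSpace ℂ K₁]

theorem dense_algTensor {D : Submodule ℂ H} (hD : Dense (D : Set H)) :
    Dense (algTensor K₁ D : Set (HTensor K₁ H)) := by
  have h : ∀ (c : K₁) (v : H), htmul c v ∈ (algTensor K₁ D).topologicalClosure := fun c v =>
    map_mem_closure (leftTensor H c).continuous (hD v) fun w hw => htmul_mem_algTensor c hw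
  intro w
  change w ∈ (algTensor K₁ D).topologicalClosure
  induction w using UniformSpace.Completion.induction_on with
  | hp => exact (Submodule.isClosed_topologicalClosure _)
  | ih w =>
    induction w using TensorProduct.induction_on with
    | zero => rw [UniformSpace.Completion.coe_zero]; exact zero_mem _
    | tmul c v => exact h c v
    | add p q hp hq => rw [UniformSpace.Completion.coe_add]; exact add_mem hp hq

theorem algTensor_ext {D : Submodule ℂ H} {G : Type*} [AddCommGroup G] [Module ℂ G]
    {T T' : algTensor K₁ D →ₗ[ℂ] G}
    (h : ∀ (c : K₁) (v : D), T ⟨htmul c v, htmul_mem_algTensor c v.2⟩ =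
      T' ⟨htmul c v, htmul_mem_algTensor c v.2⟩) : T = T' := by
  have : T ∘ₗ (algTensorEquiv K₁ D).toLinearMap = T' ∘ₗ (algTensorEquiv K₁ D).toLinearMap :=
    TensorProduct.ext' h
  ext w
  obtain ⟨t, rfl⟩ := (algTensorEquiv K₁ D).surjective w
  exact congrArg (fun f : K₁ ⊗[ℂ] D →ₗ[ℂ] G => f t) this

end AlgTensor

/-! ### Operators and their matrices. -/

section OfMatrix

variable {H : Type*} [NormedAddCommGroup H] [InnerProductSpace ℂ H] [CompleteSpace H]
  {M : VonNeumannAlgebra H} {ξ : H}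
  {K₁ : Type*} [NormedAddCommGroup K₁] [InnerProductSpace ℂ K₁]
  {K₂ : Type*} [NormedAddCommGroup K₂] [InnerProductSpace ℂ K₂]

theorem apply_mem_XiSpace {x : H →L[ℂ] H} (hx : x ∈ M.commutant) :
    x ξ ∈ XiSpace M ξ := mem_orbit.2 ⟨x, hx, rfl⟩

theorem id_mem_XiSpace : ∀ x ∈ M.commutant, ∀ v ∈ XiSpace M ξ,
    (id x : H →L[ℂ] H) v ∈ XiSpace M ξ := by
  rintro x hx _ ⟨y, rfl⟩
  exact apply_mem_XiSpace (mul_mem hx y.2)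

theorem amp_mem_algTensor : ∀ x ∈ M.commutant, ∀ w ∈ algTensor K₁ (XiSpace M ξ),
    amp K₁ x w ∈ algTensor K₁ (XiSpace M ξ) := by
  rintro x hx _ ⟨t, rfl⟩
  induction t using TensorProduct.induction_on with
  | zero => rw [map_zero, map_zero]; exact zero_mem _
  | tmul c v =>
    change amp K₁ x (htmul c (v : H)) ∈ _
    rw [amp_htmul]
    exact htmul_mem_algTensor c (id_mem_XiSpace x hx v v.2)
  | add p q hp hq => rw [map_add, map_add]; exact add_mem hp hq

theorem XiTensor_ext {G : Type*} [AddCommGroup G] [Module ℂ G]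
    {T T' : algTensor K₁ (XiSpace M ξ) →ₗ[ℂ] G}
    (h : ∀ (c : K₁) (x : H →L[ℂ] H) (hx : x ∈ M.commutant),
      T ⟨htmul c (x ξ), htmul_mem_algTensor c (apply_mem_XiSpace hx)⟩ =
        T' ⟨htmul c (x ξ), htmul_mem_algTensor c (apply_mem_XiSpace hx)⟩) : T = T' := by
  refine algTensor_ext fun c v => ?_
  obtain ⟨_, x, rfl⟩ := v
  exact h c x x.2

theorem onXi_apply {G : Type*} [AddCommGroup G] [Module ℂ G]
    (T : algTensor K₁ (XiSpace M ξ) →ₗ[ℂ] G) (c : K₁) :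
    onXi T c = T ⟨htmul c ξ, htmul_mem_algTensor c (self_mem_orbit _ _)⟩ := rfl

@[simp] theorem onXi_ofMatrix (hξ : IsCyclicSeparating M ξ) (B : K₁ →ₗ[ℂ] HTensor K₂ H) :
    onXi (ofMatrix hξ B) = B := by
  ext c
  refine (ofMatrix_htmul hξ B c (one_mem _)).trans ?_
  rw [(isAmpliation_amp K₂).map_one]; rfl

/-- Applied to `c ⊗ yξ`, both orders of composition with `I ⊗ x` give `(I ⊗ xy) B c`. -/
theorem ofMatrix_mem_OpM (hξ : IsCyclicSeparating M ξ) (B : K₁ →ₗ[ℂ] HTensor K₂ H) :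
    ofMatrix hξ B ∈ OpM M ξ K₁ K₂ := by
  rw [OpM, mem_OpAff_iff (isAmpliation_amp K₁) (isAmpliation_amp K₂) amp_mem_algTensor]
  intro x hx v
  let X : algTensor K₁ (XiSpace M ξ) →ₗ[ℂ] algTensor K₁ (XiSpace M ξ) :=
    (amp K₁ x).toLinearMap.restrict (amp_mem_algTensor x hx)
  suffices h : ofMatrix hξ B ∘ₗ X = (amp K₂ x).toLinearMap ∘ₗ ofMatrix hξ B from
    congrArg (fun f : algTensor K₁ (XiSpace M ξ) →ₗ[ℂ] HTensor K₂ H => f v) h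
  refine XiTensor_ext fun c y hy => ?_
  have e : X ⟨htmul c (y ξ), htmul_mem_algTensor c (apply_mem_XiSpace hy)⟩ =
      ⟨htmul c ((x * y) ξ), htmul_mem_algTensor c (apply_mem_XiSpace (mul_mem hx hy))⟩ :=
    Subtype.ext (amp_htmul x c (y ξ))
  rw [LinearMap.comp_apply, LinearMap.comp_apply, e, ofMatrix_htmul hξ B c (mul_mem hx hy),
    ofMatrix_htmul hξ B c hy, (isAmpliation_amp K₂).map_mul]
  rfl

/-- An operator which is affiliated is determined by its matrix. -/
theorem eq_ofMatrix_onXi (hξ : IsCyclicSeparating M ξ)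
    {T : algTensor K₁ (XiSpace M ξ) →ₗ[ℂ] HTensor K₂ H} (hT : T ∈ OpM M ξ K₁ K₂) :
    T = ofMatrix hξ (onXi T) := by
  rw [OpM, mem_OpAff_iff (isAmpliation_amp K₁) (isAmpliation_amp K₂) amp_mem_algTensor] at hT
  refine XiTensor_ext fun c x hx => ?_
  rw [ofMatrix_htmul hξ _ c hx, onXi_apply, ← hT x hx]
  exact congrArg T (Subtype.ext (amp_htmul x c ξ).symm)

variable (M ξ) in
/-- The matrix relation `B* (I ⊗ x') E_ξ = E_ξ* (I ⊗ x') B'`, `x' ∈ M'`. -/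
def DagPair (B : K₁ →ₗ[ℂ] HTensor K₂ H) (B' : K₂ →ₗ[ℂ] HTensor K₁ H) : Prop :=
  ∀ x ∈ M.commutant, ∀ c₁ c₂,
    inner ℂ (B c₁) (htmul c₂ (x ξ)) = inner ℂ (htmul c₁ (star x ξ)) (B' c₂)

theorem DagPair.symm {B : K₁ →ₗ[ℂ] HTensor K₂ H} {B' : K₂ →ₗ[ℂ] HTensor K₁ H}
    (h : DagPair M ξ B B') : DagPair M ξ B' B := fun x hx c₂ c₁ => by
  have := h (star x) (star_mem hx) c₁ c₂
  rw [star_star] at this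
  rw [← inner_conj_symm, ← this, inner_conj_symm]

/-- It suffices to test adjointness on `c₁ ⊗ ξ` and `c₂ ⊗ xξ`: affiliation turns `T' (c₂ ⊗ xξ)` into
`(I ⊗ x) T' (c₂ ⊗ ξ)`. -/
theorem AdjPair.dagPair {T : algTensor K₁ (XiSpace M ξ) →ₗ[ℂ] HTensor K₂ H}
    {T' : algTensor K₂ (XiSpace M ξ) →ₗ[ℂ] HTensor K₁ H} (h : AdjPair T T')
    (hξ : IsCyclicSeparating M ξ) (hT' : T' ∈ OpM M ξ K₂ K₁) :
    DagPair M ξ (onXi T) (onXi T') := by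
  intro x hx c₁ c₂
  have h1 := h ⟨htmul c₁ ξ, htmul_mem_algTensor c₁ (self_mem_orbit _ _)⟩
    ⟨htmul c₂ (x ξ), htmul_mem_algTensor c₂ (apply_mem_XiSpace hx)⟩
  rw [eq_ofMatrix_onXi hξ hT', ofMatrix_htmul hξ _ _ hx, (isAmpliation_amp K₁).inner_left,
    amp_htmul] at h1
  rw [onXi_apply T, ← inner_conj_symm, ← h1, inner_conj_symm]

/-- For `c₁ ⊗ xξ` and `c₂ ⊗ yξ`, moving `x` to the other side leaves the matrix relation for the
single operator `x*y ∈ M'`; linearity in each argument does the rest. -/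
theorem DagPair.adjPair {B : K₁ →ₗ[ℂ] HTensor K₂ H} {B' : K₂ →ₗ[ℂ] HTensor K₁ H}
    (h : DagPair M ξ B B') (hξ : IsCyclicSeparating M ξ) :
    AdjPair (ofMatrix hξ B) (ofMatrix hξ B') := by
  suffices key : ∀ c₂ y (hy : y ∈ M.commutant), ∀ v : algTensor K₁ (XiSpace M ξ),
      inner ℂ (ofMatrix hξ B' ⟨htmul c₂ (y ξ), htmul_mem_algTensor c₂ (apply_mem_XiSpace hy)⟩)
        (v : HTensor K₁ H) = inner ℂ (htmul c₂ (y ξ)) (ofMatrix hξ B v) by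
    intro v w
    obtain ⟨t, rfl⟩ := (algTensorEquiv K₂ (XiSpace M ξ)).surjective w
    induction t using TensorProduct.induction_on with
    | zero => simp
    | tmul c w => obtain ⟨_, y, rfl⟩ := w; exact key c y y.2 v
    | add p q hp hq =>
      rw [map_add, map_add, inner_add_left, hp, hq, ← inner_add_left]; rfl
  intro c₂ y hy v
  obtain ⟨t, rfl⟩ := (algTensorEquiv K₁ (XiSpace M ξ)).surjective v
  induction t using TensorProduct.induction_on with
  | zero => simp
  | tmul c₁ v =>
    obtain ⟨_, x, rfl⟩ := v
    have hx : (x : H →L[ℂ] H) ∈ M.commutant := x.2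
    have h1 := h _ (mul_mem (star_mem hx) hy) c₁ c₂
    change inner ℂ (ofMatrix hξ B' ⟨htmul c₂ (y ξ), _⟩) (htmul c₁ ((x : H →L[ℂ] H) ξ)) =
      inner ℂ (htmul c₂ (y ξ)) (ofMatrix hξ B ⟨htmul c₁ ((x : H →L[ℂ] H) ξ), _⟩)
    rw [ofMatrix_htmul hξ _ _ hy, ofMatrix_htmul hξ _ _ hx, (isAmpliation_amp K₁).inner_left,
      ← inner_conj_symm (htmul c₂ (y ξ)), (isAmpliation_amp K₂).inner_left, amp_htmul, amp_htmul,
      ← inner_conj_symm]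
    congr 1
    rw [star_mul, star_star] at h1
    exact h1.symm
  | add p q hp hq =>
    rw [map_add, map_add, inner_add_right, ← hp, ← hq, ← inner_add_right]; rfl

end OfMatrix

/-! ### Partial transposes. -/

section PartialTranspose

variable {H : Type*} [NormedAddCommGroup H] [InnerProductSpace ℂ H]
  {K₁ : Type*} [NormedAddCommGroup K₁] [InnerProductSpace ℂ K₁]
  {K₂ : Type*} [NormedAddCommGroup K₂] [InnerProductSpace ℂ K₂]
  {k₁ : HilbertConj K₁} {k₂ : HilbertConj K₂}

theorem isPartialTranspose_partialTranspose [CompleteSpace K₁] [CompleteSpace H]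
    (k₁ : HilbertConj K₁) (k₂ : HilbertConj K₂) {B : K₁ →ₗ[ℂ] HTensor K₂ H}
    (hB : IsHilbertSchmidt B) : IsPartialTranspose k₁ k₂ B (partialTranspose k₁ k₂ B) := by
  rw [partialTranspose, dif_pos hB]
  exact (existsUnique_partialTranspose k₁ k₂ B hB).choose_spec.1

theorem IsPartialTranspose.unique {B : K₁ →ₗ[ℂ] HTensor K₂ H} {C C' : K₂ →L[ℂ] HTensor K₁ H}
    (h : IsPartialTranspose k₁ k₂ B C) (h' : IsPartialTranspose k₁ k₂ B C') : C = C' := by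
  ext c
  exact htensor_ext_inner fun c₁ v => (h c₁ c v).trans (h' c₁ c v).symm

theorem IsPartialTranspose.symm {B : K₁ →L[ℂ] HTensor K₂ H} {C : K₂ →L[ℂ] HTensor K₁ H}
    (h : IsPartialTranspose k₁ k₂ B C) : IsPartialTranspose k₂ k₁ C B := fun c₂ c₁ v => by
  have := h (k₁ c₁) (k₂ c₂) v
  rw [k₁.involutive, k₂.involutive] at this
  exact this.symm

theorem IsPartialTranspose.partialTranspose_eq [CompleteSpace K₁] [CompleteSpace H]
    {B : K₁ →ₗ[ℂ] HTensor K₂ H} {C : K₂ →L[ℂ] HTensor K₁ H}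
    (h : IsPartialTranspose k₁ k₂ B C) (hB : IsHilbertSchmidt B) :
    partialTranspose k₁ k₂ B = C :=
  (isPartialTranspose_partialTranspose k₁ k₂ hB).unique h

/-- The coefficients of `C` are those of `B` with the two indices from `K₁` and `K₂` exchanged and
their bases conjugated, so the sums of squares agree. -/
theorem IsPartialTranspose.isHilbertSchmidt [CompleteSpace K₁] [CompleteSpace K₂]
    [CompleteSpace H] {B : K₁ →ₗ[ℂ] HTensor K₂ H} {C : K₂ →L[ℂ] HTensor K₁ H}
    (h : IsPartialTranspose k₁ k₂ B C) (hB : IsHilbertSchmidt B) :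
    IsHilbertSchmidt (C : K₂ →ₗ[ℂ] HTensor K₁ H) := by
  obtain ⟨s, b, -⟩ := exists_hilbertBasis ℂ K₁
  obtain ⟨t, f, -⟩ := exists_hilbertBasis ℂ K₂
  obtain ⟨u, g, -⟩ := exists_hilbertBasis ℂ H
  rw [isHilbertSchmidt_iff f]
  have hB' := (isHilbertSchmidt_iff (k₁.basis b) hB.toCLM).1 hB
  convert hB' using 1
  simp only [← tsum_enorm_inner_sq (htensorBasis b g),
    ← tsum_enorm_inner_sq (htensorBasis (k₂.basis f) g), htensorBasis_apply,
    HilbertConj.basis_apply, ENNReal.tsum_prod']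
  rw [ENNReal.tsum_comm]
  exact tsum_congr fun i => tsum_congr fun j => tsum_congr fun l => by rw [h]; rfl

end PartialTranspose

/-! ### The adjointable matrix space as a space of pairs of matrices. -/

section AdjMatrix

variable {H : Type*} [NormedAddCommGroup H] [InnerProductSpace ℂ H] [CompleteSpace H]
  {M : VonNeumannAlgebra H} {ξ : H}
  {K₁ : Type*} [NormedAddCommGroup K₁] [InnerProductSpace ℂ K₁]
  {K₂ : Type*} [NormedAddCommGroup K₂] [InnerProductSpace ℂ K₂]
  {k₁ : HilbertConj K₁} {k₂ : HilbertConj K₂}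

/-- After conjugation of both first legs this is the original relation. It is what makes adjoint and
transpose commute. -/
theorem DagPair.partialTranspose {B : K₁ →ₗ[ℂ] HTensor K₂ H} {B' : K₂ →ₗ[ℂ] HTensor K₁ H}
    (h : DagPair M ξ B B') {C : K₂ →L[ℂ] HTensor K₁ H} {C' : K₁ →L[ℂ] HTensor K₂ H}
    (hC : IsPartialTranspose k₁ k₂ B C) (hC' : IsPartialTranspose k₂ k₁ B' C') :
    DagPair M ξ (C : K₂ →ₗ[ℂ] HTensor K₁ H) (C' : K₁ →ₗ[ℂ] HTensor K₂ H) := fun x hx c₂ c₁ => by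
  change inner ℂ (C c₂) _ = inner ℂ _ (C' c₁)
  rw [← inner_conj_symm, hC, hC', inner_conj_symm]
  exact h x hx _ _

theorem dagM_ofMatrix (hξ : IsCyclicSeparating M ξ) {B : K₁ →ₗ[ℂ] HTensor K₂ H}
    {B' : K₂ →ₗ[ℂ] HTensor K₁ H} (h : DagPair M ξ B B') :
    dagM (ofMatrix hξ B) = ofMatrix hξ B' :=
  (h.adjPair hξ).dag_eq (dense_algTensor hξ.dense_commutant)

theorem OpM_of_adjPair (hξ : IsCyclicSeparating M ξ)
    {T : algTensor K₁ (XiSpace M ξ) →ₗ[ℂ] HTensor K₂ H}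
    {T' : algTensor K₂ (XiSpace M ξ) →ₗ[ℂ] HTensor K₁ H} (h : AdjPair T T')
    (hT : T ∈ OpM M ξ K₁ K₂) : T' ∈ OpM M ξ K₂ K₁ :=
  h.mem_OpAff (isAmpliation_amp K₁) (isAmpliation_amp K₂) amp_mem_algTensor amp_mem_algTensor
    (dense_algTensor hξ.dense_commutant) hT

theorem mem_OpDagM_iff_dagPair (hξ : IsCyclicSeparating M ξ)
    {T : algTensor K₁ (XiSpace M ξ) →ₗ[ℂ] HTensor K₂ H} :
    T ∈ OpDagM M ξ K₁ K₂ ↔ ∃ B B', DagPair M ξ B B' ∧ T = ofMatrix hξ B := by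
  constructor
  · rintro ⟨h1, h2⟩
    have h3 := adjPair_dag (dense_algTensor hξ.dense_commutant) h1
    exact ⟨onXi T, _, h3.dagPair hξ (OpM_of_adjPair hξ h3 h2), eq_ofMatrix_onXi hξ h2⟩
  · rintro ⟨B, B', h, rfl⟩
    exact ⟨(h.adjPair hξ).mem_OpDag, ofMatrix_mem_OpM hξ B⟩

/-- The affiliation of `T†` demanded by the definition is automatic. -/
theorem adjMatrixSpace_eq (hξ : IsCyclicSeparating M ξ) :
    adjMatrixSpace M ξ K₁ K₂ =
      {T | T ∈ OpDagM M ξ K₁ K₂ ∧ IsHilbertSchmidt (onXi T) ∧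
        IsHilbertSchmidt (onXi (dagM T))} := by
  ext T
  constructor
  · rintro ⟨⟨⟨-, h1⟩, h2⟩, -, h3⟩
    exact ⟨h2, h1, h3⟩
  · rintro ⟨h2, h1, h3⟩
    exact ⟨⟨⟨h2.2, h1⟩, h2⟩,
      OpM_of_adjPair hξ (adjPair_dag (dense_algTensor hξ.dense_commutant) h2.1) h2.2, h3⟩

/-- The reduction used from here on: unbounded operators are replaced by pairs `(B, B')`, with `T† =
B'^ξ`. -/
theorem mem_adjMatrixSpace_iff (hξ : IsCyclicSeparating M ξ)
    {T : algTensor K₁ (XiSpace M ξ) →ₗ[ℂ] HTensor K₂ H} :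
    T ∈ adjMatrixSpace M ξ K₁ K₂ ↔ ∃ B B', IsHilbertSchmidt B ∧ IsHilbertSchmidt B' ∧
      DagPair M ξ B B' ∧ T = ofMatrix hξ B := by
  rw [adjMatrixSpace_eq hξ]
  constructor
  · rintro ⟨h1, h2, h3⟩
    obtain ⟨B, B', h, rfl⟩ := (mem_OpDagM_iff_dagPair hξ).1 h1
    rw [dagM_ofMatrix hξ h] at h3
    rw [onXi_ofMatrix] at h2 h3
    exact ⟨B, B', h2, h3, h, rfl⟩
  · rintro ⟨B, B', h1, h2, h, rfl⟩
    refine ⟨(mem_OpDagM_iff_dagPair hξ).2 ⟨B, B', h, rfl⟩, ?_, ?_⟩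
    · rwa [onXi_ofMatrix]
    · rwa [dagM_ofMatrix hξ h, onXi_ofMatrix]

theorem matTranspose_ofMatrix [CompleteSpace K₁] (hξ : IsCyclicSeparating M ξ)
    {B : K₁ →ₗ[ℂ] HTensor K₂ H} (hB : IsHilbertSchmidt B) {C : K₂ →L[ℂ] HTensor K₁ H}
    (hC : IsPartialTranspose k₁ k₂ B C) :
    matTranspose hξ k₁ k₂ (ofMatrix hξ B) = ofMatrix hξ (C : K₂ →ₗ[ℂ] HTensor K₁ H) := by
  rw [matTranspose, onXi_ofMatrix, hC.partialTranspose_eq hB]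

theorem dagPair_iff [CompleteSpace K₁] [CompleteSpace K₂] {B : K₁ →L[ℂ] HTensor K₂ H}
    {B' : K₂ →L[ℂ] HTensor K₁ H} :
    DagPair M ξ (B : K₁ →ₗ[ℂ] HTensor K₂ H) (B' : K₂ →ₗ[ℂ] HTensor K₁ H) ↔
      ∀ x' ∈ M.commutant, adjoint B ∘L amp K₂ x' ∘L ketAmp K₂ ξ =
        adjoint (ketAmp K₁ ξ) ∘L amp K₁ x' ∘L B' := by
  have key : ∀ x' c₁ c₂, inner ℂ c₁ ((adjoint B ∘L amp K₂ x' ∘L ketAmp K₂ ξ) c₂) =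
      inner ℂ (B c₁) (htmul c₂ (x' ξ)) := fun x' c₁ c₂ => by
    simp [ContinuousLinearMap.adjoint_inner_right]
  have key' : ∀ x' c₁ c₂, inner ℂ c₁ ((adjoint (ketAmp K₁ ξ) ∘L amp K₁ x' ∘L B') c₂) =
      inner ℂ (htmul c₁ (star x' ξ)) (B' c₂) := fun x' c₁ c₂ => by
    rw [← amp_htmul, (isAmpliation_amp K₁).inner_left, star_star]
    simp [ContinuousLinearMap.adjoint_inner_right]
  constructor
  · intro h x hx
    ext c₂
    refine ext_inner_left ℂ fun c₁ => ?_
    rw [key, key']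
    exact h x hx c₁ c₂
  · intro h x hx c₁ c₂
    have := congrArg (fun f : K₂ →L[ℂ] K₁ => inner ℂ c₁ (f c₂)) (h x hx)
    rwa [key, key'] at this

theorem adjMatrixSpace_eq_ofMatrix [CompleteSpace K₁] [CompleteSpace K₂]
    (hξ : IsCyclicSeparating M ξ) :
    adjMatrixSpace M ξ K₁ K₂ =
      {T | ∃ B ∈ HSDag M ξ K₁ K₂, T = ofMatrix hξ (B : K₁ →ₗ[ℂ] _)} := by
  ext T
  rw [mem_adjMatrixSpace_iff hξ]
  constructor
  · rintro ⟨B, B', hB, hB', h, rfl⟩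
    exact ⟨hB.toCLM, ⟨hB, hB'.toCLM, hB', dagPair_iff.1 h⟩, rfl⟩
  · rintro ⟨B, ⟨hB, B', hB', h⟩, rfl⟩
    exact ⟨B, B', hB, hB', dagPair_iff.2 h, rfl⟩

theorem ofMatrix_add (hξ : IsCyclicSeparating M ξ) (B C : K₁ →ₗ[ℂ] HTensor K₂ H) :
    ofMatrix hξ (B + C) = ofMatrix hξ B + ofMatrix hξ C :=
  XiTensor_ext fun c x hx => by
    rw [LinearMap.add_apply, ofMatrix_htmul hξ _ c hx, ofMatrix_htmul hξ _ c hx,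
      ofMatrix_htmul hξ _ c hx, LinearMap.add_apply, map_add]

theorem ofMatrix_smul (hξ : IsCyclicSeparating M ξ) (a : ℂ) (B : K₁ →ₗ[ℂ] HTensor K₂ H) :
    ofMatrix hξ (a • B) = a • ofMatrix hξ B :=
  XiTensor_ext fun c x hx => by
    rw [LinearMap.smul_apply, ofMatrix_htmul hξ _ c hx, ofMatrix_htmul hξ _ c hx,
      LinearMap.smul_apply, map_smul]

/-- The adjointable matrix space is a subspace. -/
def adjMatrixSubmodule [CompleteSpace K₁] [CompleteSpace K₂] (hξ : IsCyclicSeparating M ξ) :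
    Submodule ℂ (algTensor K₁ (XiSpace M ξ) →ₗ[ℂ] HTensor K₂ H) where
  carrier := adjMatrixSpace M ξ K₁ K₂
  add_mem' {S T} hS hT := by
    obtain ⟨B, B', hB, hB', h, rfl⟩ := (mem_adjMatrixSpace_iff hξ).1 hS
    obtain ⟨C, C', hC, hC', h', rfl⟩ := (mem_adjMatrixSpace_iff hξ).1 hT
    refine (mem_adjMatrixSpace_iff hξ).2 ⟨B + C, B' + C', hB.add hC, hB'.add hC',
      fun x hx c₁ c₂ => ?_, (ofMatrix_add hξ B C).symm⟩
    rw [LinearMap.add_apply, LinearMap.add_apply, inner_add_left, inner_add_right, h x hx,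
      h' x hx]
  zero_mem' := (mem_adjMatrixSpace_iff hξ).2 ⟨0, 0, .zero, .zero,
    fun x hx c₁ c₂ => by simp, by simpa using (ofMatrix_smul hξ (K₁ := K₁) (K₂ := K₂) 0 0).symm⟩
  smul_mem' a T hT := by
    obtain ⟨B, B', hB, hB', h, rfl⟩ := (mem_adjMatrixSpace_iff hξ).1 hT
    -- The partner depends conjugate-linearly on `B`, as an adjoint does.
    refine (mem_adjMatrixSpace_iff hξ).2 ⟨a • B, conj a • B', hB.smul a, hB'.smul _,
      fun x hx c₁ c₂ => ?_, (ofMatrix_smul hξ a B).symm⟩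
    rw [LinearMap.smul_apply, LinearMap.smul_apply, inner_smul_left, inner_smul_right, h x hx]

/-! ### Tensor products of operators -/

theorem OpAff_id_apply {X : XiSpace M ξ →ₗ[ℂ] H} (hX : X ∈ OpAff M id id (XiSpace M ξ))
    {x : H →L[ℂ] H} (hx : x ∈ M.commutant) :
    X ⟨x ξ, apply_mem_XiSpace hx⟩ = x (valXi X) :=
  (mem_OpAff_iff isAmpliation_id isAmpliation_id id_mem_XiSpace).1 hX x hx
    ⟨ξ, self_mem_orbit _ _⟩

/-- The matrix of `A ⊗ X` is `c ↦ A c ⊗ X ξ`, so adjoints and transposes of such operators can be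
read off from `A` and `X ξ`. -/
theorem tensorOp_eq_ofMatrix (hξ : IsCyclicSeparating M ξ) (A : K₁ →L[ℂ] K₂)
    {X : XiSpace M ξ →ₗ[ℂ] H} (hX : X ∈ OpAff M id id (XiSpace M ξ)) :
    tensorOp A X = ofMatrix hξ ((ketAmp K₂ (valXi X) ∘L A : K₁ →L[ℂ] _) : K₁ →ₗ[ℂ] _) :=
  XiTensor_ext fun c x hx => by
    rw [ofMatrix_htmul hξ _ c hx]
    refine (tensorOp_htmul A X c ⟨x ξ, apply_mem_XiSpace hx⟩).trans ?_
    rw [OpAff_id_apply hX hx]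
    exact (amp_htmul x (A c) (valXi X)).symm

theorem dag_mem_OpDagAff_id (hξ : IsCyclicSeparating M ξ) {X : XiSpace M ξ →ₗ[ℂ] H}
    (hX : X ∈ OpDagAff M id id (XiSpace M ξ) (XiSpace M ξ)) :
    dag (XiSpace M ξ) X ∈ OpDagAff M id id (XiSpace M ξ) (XiSpace M ξ) := by
  have h := adjPair_dag hξ.dense_commutant hX.1
  exact ⟨h.symm.mem_OpDag, h.mem_OpAff isAmpliation_id isAmpliation_id id_mem_XiSpace
    id_mem_XiSpace hξ.dense_commutant hX.2⟩

theorem dagPair_ketAmp_comp [CompleteSpace K₁] [CompleteSpace K₂] (hξ : IsCyclicSeparating M ξ)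
    (A : K₁ →L[ℂ] K₂) {X : XiSpace M ξ →ₗ[ℂ] H}
    (hX : X ∈ OpDagAff M id id (XiSpace M ξ) (XiSpace M ξ)) :
    DagPair M ξ ((ketAmp K₂ (valXi X) ∘L A : K₁ →L[ℂ] _) : K₁ →ₗ[ℂ] HTensor K₂ H)
      ((ketAmp K₁ (valXi (dag (XiSpace M ξ) X)) ∘L adjoint A : K₂ →L[ℂ] _) :
        K₂ →ₗ[ℂ] HTensor K₁ H) := by
  intro x hx c₁ c₂
  change inner ℂ (htmul (A c₁) (valXi X)) (htmul c₂ (x ξ)) =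
    inner ℂ (htmul c₁ (star x ξ)) (htmul (adjoint A c₂) (valXi (dag (XiSpace M ξ) X)))
  rw [inner_htmul, inner_htmul, ContinuousLinearMap.adjoint_inner_right]
  congr 1
  have h := adjPair_dag hξ.dense_commutant hX.1 ⟨ξ, self_mem_orbit _ _⟩
    ⟨x ξ, apply_mem_XiSpace hx⟩
  rw [OpAff_id_apply (dag_mem_OpDagAff_id hξ hX).2 hx] at h
  rw [← inner_conj_symm, valXi, ← h, inner_conj_symm, ContinuousLinearMap.star_eq_adjoint,
    ContinuousLinearMap.adjoint_inner_left]

theorem dagM_tensorOp [CompleteSpace K₁] [CompleteSpace K₂] (hξ : IsCyclicSeparating M ξ)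
    (A : K₁ →L[ℂ] K₂) {X : XiSpace M ξ →ₗ[ℂ] H}
    (hX : X ∈ OpDagAff M id id (XiSpace M ξ) (XiSpace M ξ)) :
    dagM (tensorOp A X) = tensorOp (adjoint A) (dag (XiSpace M ξ) X) := by
  rw [tensorOp_eq_ofMatrix hξ A hX.2, dagM_ofMatrix hξ (dagPair_ketAmp_comp hξ A hX),
    tensorOp_eq_ofMatrix hξ _ (dag_mem_OpDagAff_id hξ hX).2]

theorem tensorOp_mem_adjMatrixSpace [CompleteSpace K₁] [CompleteSpace K₂]
    (hξ : IsCyclicSeparating M ξ) {A : K₁ →L[ℂ] K₂} (hA : IsHilbertSchmidt (A : K₁ →ₗ[ℂ] K₂))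
    {X : XiSpace M ξ →ₗ[ℂ] H} (hX : X ∈ OpDagAff M id id (XiSpace M ξ) (XiSpace M ξ)) :
    tensorOp A X ∈ adjMatrixSpace M ξ K₁ K₂ :=
  (mem_adjMatrixSpace_iff hξ).2 ⟨_, _, hA.clm_comp _, hA.adjoint.clm_comp _,
    dagPair_ketAmp_comp hξ A hX, tensorOp_eq_ofMatrix hξ A hX.2⟩

theorem HSTensorOp_subset [CompleteSpace K₁] [CompleteSpace K₂] (hξ : IsCyclicSeparating M ξ) :
    (HSTensorOp M ξ K₁ K₂ : Set _) ⊆ adjMatrixSpace M ξ K₁ K₂ := by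
  have : HSTensorOp M ξ K₁ K₂ ≤ adjMatrixSubmodule hξ := by
    refine Submodule.span_le.2 ?_
    rintro _ ⟨A, hA, X, hX, rfl⟩
    exact tensorOp_mem_adjMatrixSpace hξ hA hX
  exact this

theorem matTranspose_tensorOp [CompleteSpace K₁] [CompleteSpace K₂]
    (hξ : IsCyclicSeparating M ξ) {A : K₁ →L[ℂ] K₂} (hA : IsHilbertSchmidt (A : K₁ →ₗ[ℂ] K₂))
    {X : XiSpace M ξ →ₗ[ℂ] H} (hX : X ∈ OpAff M id id (XiSpace M ξ)) :
    matTranspose hξ k₁ k₂ (tensorOp A X) = tensorOp (transposeOp k₁ k₂ A) X := by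
  rw [tensorOp_eq_ofMatrix hξ A hX, tensorOp_eq_ofMatrix hξ _ hX]
  refine matTranspose_ofMatrix hξ (hA.clm_comp _) fun c₁ c₂ v => ?_
  change inner ℂ (htmul c₁ v) (htmul (transposeOp k₁ k₂ A c₂) (valXi X)) =
    inner ℂ (htmul (k₂ c₂) v) (htmul (A (k₁ c₁)) (valXi X))
  rw [inner_htmul, inner_htmul, transposeOp, ContinuousLinearMap.adjoint_inner_right]
  congr 1
  change inner ℂ (k₂ (A (k₁ c₁))) c₂ = _
  exact k₂.inner_left _ _

/-- If `M` consists of scalars, then `H` is spanned by `ξ`. -/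
theorem exists_smul_eq_of_scalar (hξ : IsCyclicSeparating M ξ)
    (hM : ∀ x ∈ M, ∃ z : ℂ, x = z • (1 : H →L[ℂ] H)) (v : H) : ∃ z : ℂ, v = z • ξ := by
  have h : (orbit M ξ : Submodule ℂ H) ≤ Submodule.span ℂ {ξ} := by
    rintro _ ⟨x, rfl⟩
    obtain ⟨z, hz⟩ := hM x x.2
    exact Submodule.mem_span_singleton.2 ⟨z, by
      change _ = (x : H →L[ℂ] H) ξ
      rw [hz]; rfl⟩
  have hc : IsClosed (Submodule.span ℂ {ξ} : Set H) := Submodule.closed_of_finiteDimensional _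
  have := closure_minimal h hc (hξ.cyclic v)
  obtain ⟨z, hz⟩ := Submodule.mem_span_singleton.1 this
  exact ⟨z, hz.symm⟩

/-- Here `H = ℂ ξ`, so every matrix has the form `c ↦ A c ⊗ ξ`, and `X` can be taken to be the
inclusion of `Ξ`. -/
theorem HSTensorOp_eq_of_scalar [CompleteSpace K₁] [CompleteSpace K₂]
    (hξ : IsCyclicSeparating M ξ) (hM : ∀ x ∈ M, ∃ z : ℂ, x = z • (1 : H →L[ℂ] H)) :
    (HSTensorOp M ξ K₁ K₂ : Set _) = adjMatrixSpace M ξ K₁ K₂ := by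
  refine (HSTensorOp_subset hξ).antisymm fun T hT => ?_
  obtain ⟨B, B', hB, hB', h, rfl⟩ := (mem_adjMatrixSpace_iff hξ).1 hT
  have hX : (XiSpace M ξ).subtype ∈ OpDagAff M id id (XiSpace M ξ) (XiSpace M ξ) :=
    ⟨AdjPair.mem_OpDag (T' := (XiSpace M ξ).subtype) fun x y => rfl,
      (mem_OpAff_iff isAmpliation_id isAmpliation_id id_mem_XiSpace).2 fun x hx v => rfl⟩
  -- The scalar is forced by `E_ξ* E_ξ = ⟪ξ, ξ⟫ I`.
  let A : K₁ →L[ℂ] K₂ := (inner ℂ ξ ξ : ℂ)⁻¹ • (adjoint (ketAmp K₂ ξ) ∘L hB.toCLM)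
  have hA : IsHilbertSchmidt (A : K₁ →ₗ[ℂ] K₂) := (hB.clm_comp (adjoint (ketAmp K₂ ξ))).smul _
  refine Submodule.subset_span ⟨A, hA, _, hX, ?_⟩
  rw [tensorOp_eq_ofMatrix hξ A hX.2]
  congr 1
  ext c
  refine htensor_ext_inner fun c₂ v => ?_
  obtain ⟨z, rfl⟩ := exists_smul_eq_of_scalar hξ hM v
  change _ = inner ℂ _ (htmul ((inner ℂ ξ ξ : ℂ)⁻¹ • adjoint (ketAmp K₂ ξ) (B c)) ξ)
  rw [inner_htmul, inner_smul_right, ContinuousLinearMap.adjoint_inner_right, htmul_smul_right,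
    inner_smul_left, inner_smul_left, ketAmp_apply]
  -- If `ξ = 0` then `H = 0`; the inverse takes the value `0` and both sides vanish.
  by_cases h0 : ξ = 0
  · have h1 : htmul c₂ (0 : H) = 0 := (leftTensor H c₂).map_zero
    simp [h0, h1]
  · have := inner_self_ne_zero (𝕜 := ℂ).2 h0
    field_simp

end AdjMatrix

/-! ### The identification of `ℂ ⊗ H` with `H`. -/

section ScalarTensor

variable {H : Type*} [NormedAddCommGroup H] [InnerProductSpace ℂ H]

theorem htmul_eq_htmul_one (z : ℂ) (v : H) : htmul z v = htmul (1 : ℂ) (z • v) := by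
  rw [htmul_smul_right, ← htmul_smul_left, smul_eq_mul, mul_one]

theorem inner_htmul_one (v w : H) :
    inner ℂ (htmul (1 : ℂ) v) (htmul (1 : ℂ) w) = inner ℂ v w := by
  rw [inner_htmul]; simp

theorem htmul_one_injective : Function.Injective (htmul (1 : ℂ) : H → HTensor ℂ H) := by
  intro v w h
  refine ext_inner_left ℂ fun u => ?_
  rw [← inner_htmul_one, h, inner_htmul_one]

variable [CompleteSpace H]

/-- The identification of `ℂ ⊗ H` with `H`. -/
noncomputable def ofScalarTensor : HTensor ℂ H →L[ℂ] H := adjoint (leftTensor H (1 : ℂ))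

@[simp] theorem ofScalarTensor_htmul (z : ℂ) (v : H) : ofScalarTensor (htmul z v) = z • v := by
  refine ext_inner_left ℂ fun u => ?_
  rw [ofScalarTensor, inner_adjoint_leftTensor, htmul_eq_htmul_one z, inner_htmul_one]

@[simp] theorem htmul_one_ofScalarTensor (w : HTensor ℂ H) :
    htmul (1 : ℂ) (ofScalarTensor w) = w := by
  have : leftTensor H (1 : ℂ) ∘L ofScalarTensor = 1 := htensor_clm_ext fun z v => by
    change htmul (1 : ℂ) (ofScalarTensor (htmul z v)) = htmul z v
    rw [ofScalarTensor_htmul, ← htmul_eq_htmul_one]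
  exact congrArg (fun f : HTensor ℂ H →L[ℂ] HTensor ℂ H => f w) this

theorem inner_ofScalarTensor (v : H) (w : HTensor ℂ H) :
    inner ℂ v (ofScalarTensor w) = inner ℂ (htmul (1 : ℂ) v) w :=
  inner_adjoint_leftTensor _ _ _

theorem ofScalarTensor_amp (x : H →L[ℂ] H) (w : HTensor ℂ H) :
    ofScalarTensor (amp ℂ x w) = x (ofScalarTensor w) := by
  conv_lhs => rw [← htmul_one_ofScalarTensor w]
  rw [amp_htmul, ofScalarTensor_htmul, one_smul]

end ScalarTensor

/-! ### Columns, rows and the case of scalar index spaces. -/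

section ColRow

variable {H : Type*} [NormedAddCommGroup H] [InnerProductSpace ℂ H] [CompleteSpace H]
  {M : VonNeumannAlgebra H} {ξ : H}
  {K : Type*} [NormedAddCommGroup K] [InnerProductSpace ℂ K]

theorem asCol_apply (C : algTensor ℂ (XiSpace M ξ) →ₗ[ℂ] HTensor K H) (v : XiSpace M ξ) :
    asCol C v = C ⟨htmul 1 (v : H), htmul_mem_algTensor 1 v.2⟩ := rfl

theorem asCol_ofMatrix_apply (hξ : IsCyclicSeparating M ξ) (B : ℂ →ₗ[ℂ] HTensor K H)
    {x : H →L[ℂ] H} (hx : x ∈ M.commutant) :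
    asCol (ofMatrix hξ B) ⟨x ξ, apply_mem_XiSpace hx⟩ = amp K x (B 1) :=
  ofMatrix_htmul hξ B 1 hx

theorem valXi_asCol (C : algTensor ℂ (XiSpace M ξ) →ₗ[ℂ] HTensor K H) :
    valXi (asCol C) = onXi C 1 := rfl

theorem ket_apply_one {G : Type*} [AddCommGroup G] [Module ℂ G] (B : ℂ →ₗ[ℂ] G) :
    ket (B 1) = B := by
  ext; simp

theorem XiSpace_ext {G : Type*} [AddCommGroup G] [Module ℂ G] {T T' : XiSpace M ξ →ₗ[ℂ] G}
    (h : ∀ (x : H →L[ℂ] H) (hx : x ∈ M.commutant),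
      T ⟨x ξ, apply_mem_XiSpace hx⟩ = T' ⟨x ξ, apply_mem_XiSpace hx⟩) : T = T' := by
  ext ⟨_, x, rfl⟩
  exact h x x.2

theorem asCol_mem_OpAff {T : algTensor ℂ (XiSpace M ξ) →ₗ[ℂ] HTensor K H}
    (hT : T ∈ OpM M ξ ℂ K) : asCol T ∈ OpAff M id (amp K) (XiSpace M ξ) := by
  rw [OpM, mem_OpAff_iff (isAmpliation_amp ℂ) (isAmpliation_amp K) amp_mem_algTensor] at hT
  rw [mem_OpAff_iff isAmpliation_id (isAmpliation_amp K) id_mem_XiSpace]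
  intro x hx v
  refine Eq.trans ?_ (hT x hx ⟨htmul 1 (v : H), htmul_mem_algTensor 1 v.2⟩)
  exact congrArg T (Subtype.ext (amp_htmul x 1 (v : H)).symm)

theorem OpAff_col_apply {C : XiSpace M ξ →ₗ[ℂ] HTensor K H}
    (hC : C ∈ OpAff M id (amp K) (XiSpace M ξ)) {x : H →L[ℂ] H} (hx : x ∈ M.commutant) :
    C ⟨x ξ, apply_mem_XiSpace hx⟩ = amp K x (valXi C) :=
  (mem_OpAff_iff isAmpliation_id (isAmpliation_amp K) id_mem_XiSpace).1 hC x hx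
    ⟨ξ, self_mem_orbit _ _⟩

theorem eq_asCol_ofMatrix (hξ : IsCyclicSeparating M ξ) {C : XiSpace M ξ →ₗ[ℂ] HTensor K H}
    (hC : C ∈ OpAff M id (amp K) (XiSpace M ξ)) :
    C = asCol (ofMatrix hξ (ket (valXi C))) :=
  XiSpace_ext fun x hx => by
    rw [OpAff_col_apply hC hx, asCol_ofMatrix_apply hξ _ hx]; simp

theorem adjPair_asCol {T : algTensor ℂ (XiSpace M ξ) →ₗ[ℂ] HTensor K H}
    {T' : algTensor K (XiSpace M ξ) →ₗ[ℂ] HTensor ℂ H} (h : AdjPair T T') :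
    AdjPair (asCol T) (ofScalarTensor.toLinearMap ∘ₗ T') := fun v y => by
  change inner ℂ (ofScalarTensor (T' y)) (v : H) = _
  rw [← inner_conj_symm, inner_ofScalarTensor, inner_conj_symm]
  exact h ⟨htmul 1 (v : H), htmul_mem_algTensor 1 v.2⟩ y

/-- The matrix of a column is defined on `ℂ` and hence automatically Hilbert–Schmidt; only the
adjoint carries a condition. -/
theorem adjColSpace_eq [CompleteSpace K] (hξ : IsCyclicSeparating M ξ) :
    adjColSpace M ξ K =
      {C | C ∈ OpDagAff M id (amp K) (XiSpace M ξ) (algTensor K (XiSpace M ξ)) ∧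
        IsHilbertSchmidt (onXi (dag (algTensor K (XiSpace M ξ)) C))} := by
  ext C
  constructor
  · rintro ⟨T, hT, rfl⟩
    obtain ⟨B, B', hB, hB', h, rfl⟩ := (mem_adjMatrixSpace_iff hξ).1 hT
    have h' := adjPair_asCol (h.adjPair hξ)
    refine ⟨⟨h'.mem_OpDag, asCol_mem_OpAff (ofMatrix_mem_OpM hξ B)⟩, ?_⟩
    rw [h'.dag_eq hξ.dense_commutant]
    have : onXi (ofScalarTensor.toLinearMap ∘ₗ ofMatrix hξ B') =
        (ofScalarTensor : HTensor ℂ H →L[ℂ] H).toLinearMap ∘ₗ B' := by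
      conv_rhs => rw [← onXi_ofMatrix hξ B']
      rfl
    rw [this]
    exact hB'.clm_comp _
  · rintro ⟨⟨h1, h2⟩, h3⟩
    have h := adjPair_dag hξ.dense_commutant h1
    refine ⟨ofMatrix hξ (ket (valXi C)), (mem_adjMatrixSpace_iff hξ).2 ⟨_, _,
      isHilbertSchmidt_of_complex _, h3.clm_comp (leftTensor H (1 : ℂ)), fun x hx z c => ?_, rfl⟩,
      (eq_asCol_ofMatrix hξ h2).symm⟩
    change inner ℂ (z • valXi C) (htmul c (x ξ)) =
      inner ℂ (htmul z (star x ξ)) (htmul 1 (onXi (dag (algTensor K (XiSpace M ξ)) C) c))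
    have h4 := h ⟨star x ξ, apply_mem_XiSpace (star_mem hx)⟩
      ⟨htmul c ξ, htmul_mem_algTensor c (self_mem_orbit _ _)⟩
    rw [OpAff_col_apply h2 (star_mem hx)] at h4
    rw [htmul_eq_htmul_one z, inner_htmul_one, inner_smul_left, inner_smul_left, onXi_apply,
      ← inner_conj_symm (star x ξ), h4, inner_conj_symm, (isAmpliation_amp K).inner_left,
      star_star, amp_htmul]

/-- Dual to columns: the adjoint of a row is a column, whose matrix is automatically
Hilbert–Schmidt. -/
theorem adjRowSpace_eq [CompleteSpace K] (hξ : IsCyclicSeparating M ξ) :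
    adjRowSpace M ξ K =
      {R | R ∈ OpDagAff M (amp K) id (algTensor K (XiSpace M ξ)) (XiSpace M ξ) ∧
        IsHilbertSchmidt (onXi R)} := by
  ext R
  have hOp : toRow R ∈ OpM M ξ K ℂ ↔ R ∈ OpAff M (amp K) id (algTensor K (XiSpace M ξ)) := by
    rw [OpM, mem_OpAff_iff (isAmpliation_amp K) (isAmpliation_amp ℂ) amp_mem_algTensor,
      mem_OpAff_iff (isAmpliation_amp K) isAmpliation_id amp_mem_algTensor]
    refine forall₃_congr fun x hx v => ?_
    change htmul (1 : ℂ) (R _) = amp ℂ x (htmul (1 : ℂ) (R v)) ↔ _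
    rw [amp_htmul]
    exact htmul_one_injective.eq_iff
  constructor
  · intro hR
    obtain ⟨B, B', hB, hB', h, hR'⟩ := (mem_adjMatrixSpace_iff hξ).1 hR
    have h1 := h.adjPair hξ
    rw [← hR'] at h1
    have h2 : AdjPair R (asCol (ofMatrix hξ B')) := fun v y => by
      rw [asCol_apply, h1]
      exact inner_htmul_one _ _
    refine ⟨⟨h2.mem_OpDag, hOp.1 hR.1.2.2⟩, ?_⟩
    have h3 : onXi R = ofScalarTensor.toLinearMap ∘ₗ B := by
      rw [← onXi_ofMatrix hξ B, ← hR']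
      ext c
      change _ = ofScalarTensor (htmul (1 : ℂ) (R _))
      rw [ofScalarTensor_htmul, one_smul]; rfl
    rw [h3]
    exact hB.clm_comp _
  · rintro ⟨⟨h1, h2⟩, h3⟩
    have hd := dense_algTensor (K₁ := K) hξ.dense_commutant
    have h := adjPair_dag hd h1
    have h4 := h.mem_OpAff (isAmpliation_amp K) isAmpliation_id amp_mem_algTensor id_mem_XiSpace
      hd h2
    refine (mem_adjMatrixSpace_iff hξ).2 ⟨onXi (toRow R), ket (valXi (dag (XiSpace M ξ) R)),
      h3.clm_comp (leftTensor H (1 : ℂ)), isHilbertSchmidt_of_complex _, fun x hx c z => ?_,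
      eq_ofMatrix_onXi hξ (hOp.2 h2)⟩
    change inner ℂ (htmul (1 : ℂ) (onXi R c)) (htmul z (x ξ)) =
      inner ℂ (htmul c (star x ξ)) (z • valXi (dag (XiSpace M ξ) R))
    have h5 := h ⟨htmul c ξ, htmul_mem_algTensor c (self_mem_orbit _ _)⟩
      ⟨x ξ, apply_mem_XiSpace hx⟩
    rw [OpAff_col_apply h4 hx] at h5
    rw [htmul_eq_htmul_one z, inner_htmul_one, inner_smul_right, inner_smul_right, onXi_apply,
      ← inner_conj_symm, ← h5, inner_conj_symm, ← amp_htmul, (isAmpliation_amp K).inner_left,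
      star_star]

theorem HSTensorOp_complex (hξ : IsCyclicSeparating M ξ) :
    (HSTensorOp M ξ ℂ ℂ : Set _) = adjMatrixSpace M ξ ℂ ℂ := by
  refine (HSTensorOp_subset hξ).antisymm fun T hT => ?_
  obtain ⟨B, B', -, -, h, hTB⟩ := (mem_adjMatrixSpace_iff hξ).1 hT
  have h1 := adjPair_asCol (h.adjPair hξ)
  rw [← hTB] at h1
  let X : XiSpace M ξ →ₗ[ℂ] H := ofScalarTensor.toLinearMap ∘ₗ asCol T
  have hX : X ∈ OpDagAff M id id (XiSpace M ξ) (XiSpace M ξ) := by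
    constructor
    · refine AdjPair.mem_OpDag
        (T' := ofScalarTensor.toLinearMap ∘ₗ asCol (ofMatrix hξ B')) fun v y => ?_
      refine (h1 v ⟨htmul 1 (y : H), htmul_mem_algTensor 1 y.2⟩).trans ?_
      exact (inner_ofScalarTensor _ _).symm
    · have h2 := asCol_mem_OpAff hT.1.2.2
      rw [mem_OpAff_iff isAmpliation_id (isAmpliation_amp ℂ) id_mem_XiSpace] at h2
      rw [mem_OpAff_iff isAmpliation_id isAmpliation_id id_mem_XiSpace]
      intro x hx v
      exact (congrArg ofScalarTensor (h2 x hx v)).trans (ofScalarTensor_amp x _)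
  -- A single tensor suffices: `T = 1 ⊗ X`, where `X` is `T` itself read on `H`.
  refine Submodule.subset_span ⟨1, isHilbertSchmidt_of_complex _, X, hX, ?_⟩
  refine algTensor_ext fun z v => ?_
  rw [tensorOp_htmul]
  change _ = htmul z (ofScalarTensor (asCol T v))
  refine Eq.trans ?_ (htmul_eq_htmul_one z _).symm
  rw [htmul_smul_right, htmul_one_ofScalarTensor, asCol_apply, ← map_smul]
  refine congrArg T (Subtype.ext ?_)
  change htmul z (v : H) = z • htmul (1 : ℂ) (v : H)
  rw [← htmul_smul_left, smul_eq_mul, mul_one]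

end ColRow

/-! ### The operator `k ⊗ S_ξ` and the adjoint-transpose. -/

section ConjTomita

variable {H : Type*} [NormedAddCommGroup H] [InnerProductSpace ℂ H] [CompleteSpace H]
  {M : VonNeumannAlgebra H} {ξ : H}
  {K : Type*} [NormedAddCommGroup K] [InnerProductSpace ℂ K] [CompleteSpace K]

theorem graphClosure_sum {E F : Type*} [NormedAddCommGroup E] [NormedSpace ℂ E]
    [NormedAddCommGroup F] [NormedSpace ℂ F] {T : E →ₛₗ.[starRingEnd ℂ] F} {ι : Type*}
    (s : Finset ι) {p : ι → E × F} (hp : ∀ i, p i ∈ graphClosure T) :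
    ∑ i ∈ s, p i ∈ graphClosure T := by
  classical
  induction s using Finset.induction_on with
  | empty => exact graphClosure_zero
  | insert i s hi ih => rw [Finset.sum_insert hi]; exact graphClosure_add (hp i) ih

/-- `k ⊗ S_ξ` is the adjoint of `c ⊗ x' ξ ↦ k c ⊗ x'* ξ`, `x' ∈ M'`. -/
theorem mem_graphClosure_conjTensorCore_iff (k : HilbertConj K) (hξ : IsCyclicSeparating M ξ)
    {ζ η : HTensor K H} :
    (ζ, η) ∈ graphClosure (conjTensorCore k (tomita hξ)) ↔ ∀ x ∈ M.commutant, ∀ c,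
      inner ℂ (htmul c (x ξ)) η = inner ℂ ζ (htmul (k c) (star x ξ)) := by
  refine ⟨fun h x hx c => graphClosure_inner (fun w => conjTensorCore_inner k hξ w c hx) h,
    fun h => ?_⟩
  obtain ⟨s, b, -⟩ := exists_hilbertBasis ℂ K
  -- The second vector is expanded along the conjugated basis, so that the `i`-th terms have first
  -- legs `b i` and `k (b i)`.
  have h1 := hasSum_htmul_adjoint b ζ
  have h2 := hasSum_htmul_adjoint (k.basis b) η
  simp only [HilbertConj.basis_apply] at h2
  refine isClosed_closure.mem_of_tendsto (h1.prodMk h2)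
    (Filter.Eventually.of_forall fun t => graphClosure_sum t fun i => ?_)
  -- Taking `c = k (b i)` in the hypothesis leaves the scalar relation for the two slices, to which
  -- Tomita's theorem applies. The partial sums thus lie in the graph, and closedness handles the
  -- limit.
  have h3 : (adjoint (leftTensor H (b i)) ζ, adjoint (leftTensor H (k (b i))) η) ∈
      graphClosure (tomitaCore hξ) := mem_graphClosure_tomitaCore hξ fun x hx => by
    rw [inner_adjoint_leftTensor, h x hx, k.involutive, ContinuousLinearMap.adjoint_inner_left]
    rfl
  obtain ⟨h4, h5⟩ := (mem_graphClosure_iff (tomitaCore_closable hξ)).1 h3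
  refine subset_closure ⟨⟨htmul (b i) (adjoint (leftTensor H (b i)) ζ),
    htmul_mem_algTensor _ h4⟩, Prod.ext rfl ?_⟩
  refine (conjTensorCore_htmul k (tomita hξ) (b i) ⟨_, h4⟩).trans ?_
  exact congrArg (htmul (k (b i))) h5

theorem conjTomita_eq_iff (k : HilbertConj K) (hξ : IsCyclicSeparating M ξ)
    {ζ η : HTensor K H} :
    (∃ h : ζ ∈ (conjTomita k hξ).domain, conjTomita k hξ ⟨ζ, h⟩ = η) ↔ ∀ x ∈ M.commutant, ∀ c,
      inner ℂ (htmul c (x ξ)) η = inner ℂ ζ (htmul (k c) (star x ξ)) := by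
  rw [← mem_graphClosure_conjTensorCore_iff]
  exact (mem_graphClosure_iff (conjTensorCore_closable k hξ)).symm

variable {K₁ : Type*} [NormedAddCommGroup K₁] [InnerProductSpace ℂ K₁]

/-- Rewriting `C` through `B'`, and `B'` through `B`, gives the adjoint characterisation of `k ⊗
S_ξ`. In particular membership in the domain comes for free. -/
theorem DagPair.conjTomita_eq {k₁ : HilbertConj K₁} {k : HilbertConj K}
    (hξ : IsCyclicSeparating M ξ) {B : K₁ →ₗ[ℂ] HTensor K H} {B' : K →ₗ[ℂ] HTensor K₁ H}
    (h : DagPair M ξ B B') {C : K₁ →L[ℂ] HTensor K H} (hC : IsPartialTranspose k k₁ B' C)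
    (c : K₁) : ∃ h : B (k₁ c) ∈ (conjTomita k hξ).domain,
      conjTomita k hξ ⟨B (k₁ c), h⟩ = C c := by
  rw [conjTomita_eq_iff]
  intro x hx c₂
  rw [hC, h _ (star_mem hx), star_star]

/-- In one direction the adjoint-transpose of the column supplies the image of `ζ`. In the other,
the partner matrix is the partial transpose of `|η⟩` with `η = (k ⊗ S_ξ) ζ`. -/
theorem ket_mem_adjMatrixSpace_iff (k : HilbertConj K) (hξ : IsCyclicSeparating M ξ)
    {ζ : HTensor K H} :
    ofMatrix hξ (ket ζ) ∈ adjMatrixSpace M ξ ℂ K ↔ ζ ∈ (conjTomita k hξ).domain := by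
  rw [mem_adjMatrixSpace_iff hξ]
  constructor
  · rintro ⟨B, B', hB, hB', h, hBζ⟩
    have h1 := congrArg onXi hBζ
    rw [onXi_ofMatrix, onXi_ofMatrix] at h1
    obtain ⟨h2, -⟩ := h.conjTomita_eq hξ (k₁ := HilbertConj.complex)
      (isPartialTranspose_partialTranspose k _ hB') 1
    rw [← h1] at h2
    simpa [HilbertConj.complex] using h2
  · intro hζ
    have h := (conjTomita_eq_iff k hξ).1 ⟨hζ, rfl⟩
    set η := conjTomita k hξ ⟨ζ, hζ⟩
    have hη : IsHilbertSchmidt (ket η) := isHilbertSchmidt_of_complex _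
    have hT := isPartialTranspose_partialTranspose HilbertConj.complex k hη
    refine ⟨ket ζ, _, isHilbertSchmidt_of_complex _, hT.isHilbertSchmidt hη,
      fun x hx z c => ?_, rfl⟩
    refine Eq.trans ?_ (hT z c _).symm
    change inner ℂ (z • ζ) _ = inner ℂ _ (conj z • η)
    rw [inner_smul_left, inner_smul_right, h _ (star_mem hx), k.involutive, star_star]

theorem adjColSpace_eq_ket (k : HilbertConj K) (hξ : IsCyclicSeparating M ξ) :
    adjColSpace M ξ K =
      {C | ∃ ζ ∈ (conjTomita k hξ).domain, C = asCol (ofMatrix hξ (ket ζ))} := by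
  ext C
  constructor
  · rintro ⟨T, hT, rfl⟩
    obtain ⟨B, -, -, -, -, rfl⟩ := (mem_adjMatrixSpace_iff hξ).1 hT
    rw [← ket_apply_one B] at hT ⊢
    exact ⟨_, (ket_mem_adjMatrixSpace_iff k hξ).1 hT, rfl⟩
  · rintro ⟨ζ, hζ, rfl⟩
    exact ⟨_, (ket_mem_adjMatrixSpace_iff k hξ).2 hζ, rfl⟩

theorem adjColSpace_eq_valXi (k : HilbertConj K) (hξ : IsCyclicSeparating M ξ) :
    adjColSpace M ξ K =
      {C | C ∈ OpAff M id (amp K) (XiSpace M ξ) ∧ valXi C ∈ (conjTomita k hξ).domain} := by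
  rw [adjColSpace_eq_ket k hξ]
  ext C
  constructor
  · rintro ⟨ζ, hζ, rfl⟩
    refine ⟨asCol_mem_OpAff (ofMatrix_mem_OpM hξ _), ?_⟩
    rw [valXi_asCol, onXi_ofMatrix]
    simpa using hζ
  · rintro ⟨h1, h2⟩
    exact ⟨_, h2, eq_asCol_ofMatrix hξ h1⟩

variable [CompleteSpace K₁] {K₂ : Type*} [NormedAddCommGroup K₂] [InnerProductSpace ℂ K₂]
  [CompleteSpace K₂]

/-- On pairs, the adjoint is the swap and the transpose acts on both members; these are visibly
commuting involutions, so the identities become definitional once everything is written through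
`ofMatrix`. -/
theorem adjMatrixSpace_adjoint_transpose (hξ : IsCyclicSeparating M ξ) (k₁ : HilbertConj K₁)
    (k₂ : HilbertConj K₂) {T : algTensor K₁ (XiSpace M ξ) →ₗ[ℂ] HTensor K₂ H}
    (hT : T ∈ adjMatrixSpace M ξ K₁ K₂) :
    dagM T ∈ adjMatrixSpace M ξ K₂ K₁ ∧
      matTranspose hξ k₁ k₂ T ∈ adjMatrixSpace M ξ K₂ K₁ ∧
      matTranspose hξ k₂ k₁ (matTranspose hξ k₁ k₂ T) = T ∧
      dagM (dagM T) = T ∧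
      matTranspose hξ k₂ k₁ (dagM T) = dagM (matTranspose hξ k₁ k₂ T) ∧
      ∀ c : K₁, ∃ h : onXi T (k₁ c) ∈ (conjTomita k₂ hξ).domain,
        onXi (matTranspose hξ k₂ k₁ (dagM T)) c = conjTomita k₂ hξ ⟨onXi T (k₁ c), h⟩ := by
  obtain ⟨B, B', hB, hB', h, rfl⟩ := (mem_adjMatrixSpace_iff hξ).1 hT
  have hC := isPartialTranspose_partialTranspose k₁ k₂ hB
  have hC' := isPartialTranspose_partialTranspose k₂ k₁ hB'
  have hsymm : IsPartialTranspose k₂ k₁ (partialTranspose k₁ k₂ B : K₂ →ₗ[ℂ] _) hB.toCLM :=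
    IsPartialTranspose.symm (B := hB.toCLM) hC
  have hCC := h.partialTranspose hC hC'
  have hHS := hC.isHilbertSchmidt hB
  have hHS' := hC'.isHilbertSchmidt hB'
  rw [dagM_ofMatrix hξ h, matTranspose_ofMatrix hξ hB hC, matTranspose_ofMatrix hξ hB' hC',
    matTranspose_ofMatrix hξ hHS hsymm, dagM_ofMatrix hξ h.symm, dagM_ofMatrix hξ hCC]
  refine ⟨(mem_adjMatrixSpace_iff hξ).2 ⟨_, _, hB', hB, h.symm, rfl⟩,
    (mem_adjMatrixSpace_iff hξ).2 ⟨_, _, hHS, hHS', hCC, rfl⟩, rfl, rfl, rfl, fun c => ?_⟩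
  rw [onXi_ofMatrix, onXi_ofMatrix]
  obtain ⟨h1, h2⟩ := h.conjTomita_eq hξ hC' c
  exact ⟨h1, h2.symm⟩

end ConjTomita

end AdjointableMatrix

theorem mainTheorem5
    {H : Type*} [NormedAddCommGroup H] [InnerProductSpace ℂ H] [CompleteSpace H]
    (M : VonNeumannAlgebra H) (ξ : H) (hξ : IsCyclicSeparating M ξ)
    {K : Type*} [NormedAddCommGroup K] [InnerProductSpace ℂ K] [CompleteSpace K]
    (k : HilbertConj K)
    {K₁ : Type*} [NormedAddCommGroup K₁] [InnerProductSpace ℂ K₁] [CompleteSpace K₁]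
    (k₁ : HilbertConj K₁)
    {K₂ : Type*} [NormedAddCommGroup K₂] [InnerProductSpace ℂ K₂] [CompleteSpace K₂]
    (k₂ : HilbertConj K₂) :
    -- descriptions of the adjointable matrix space
    adjMatrixSpace M ξ K₁ K₂ = {T | ∃ B ∈ HSDag M ξ K₁ K₂, T = ofMatrix hξ (B : K₁ →ₗ[ℂ] _)} ∧
    adjMatrixSpace M ξ K₁ K₂ =
      {T | T ∈ OpDagM M ξ K₁ K₂ ∧ IsHilbertSchmidt (onXi T) ∧ IsHilbertSchmidt (onXi (dagM T))} ∧
    -- tensor products of Hilbert–Schmidt operators and affiliated operators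
    (HSTensorOp M ξ K₁ K₂ : Set _) ⊆ adjMatrixSpace M ξ K₁ K₂ ∧
    ((∀ x ∈ M, ∃ z : ℂ, x = z • (1 : H →L[ℂ] H)) →
      (HSTensorOp M ξ K₁ K₂ : Set _) = adjMatrixSpace M ξ K₁ K₂) ∧
    (HSTensorOp M ξ ℂ ℂ : Set _) = adjMatrixSpace M ξ ℂ ℂ ∧
    (∀ A : K₁ →L[ℂ] K₂, IsHilbertSchmidt (A : K₁ →ₗ[ℂ] K₂) →
      ∀ X ∈ OpDagAff M id id (XiSpace M ξ) (XiSpace M ξ),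
        dagM (matTranspose hξ k₁ k₂ (tensorOp A X)) =
          tensorOp (ContinuousLinearMap.adjoint (transposeOp k₁ k₂ A)) (dag (XiSpace M ξ) X) ∧
        dagM (matTranspose hξ k₁ k₂ (tensorOp A X)) =
          tensorOp (conjOp k₁ k₂ A) (dag (XiSpace M ξ) X)) ∧
    -- column and row spaces
    adjColSpace M ξ K =
      {C | C ∈ OpDagAff M id (amp K) (XiSpace M ξ) (algTensor K (XiSpace M ξ)) ∧
        IsHilbertSchmidt (onXi (dag (algTensor K (XiSpace M ξ)) C))} ∧
    adjRowSpace M ξ K =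
      {R | R ∈ OpDagAff M (amp K) id (algTensor K (XiSpace M ξ)) (XiSpace M ξ) ∧
        IsHilbertSchmidt (onXi R)} ∧
    adjColSpace M ξ K =
      {C | ∃ ζ ∈ (conjTomita k hξ).domain, C = asCol (ofMatrix hξ (ket ζ))} ∧
    adjColSpace M ξ K =
      {C | C ∈ OpAff M id (amp K) (XiSpace M ξ) ∧ valXi C ∈ (conjTomita k hξ).domain} ∧
    -- adjoint and transpose
    (∀ T ∈ adjMatrixSpace M ξ K₁ K₂,
      dagM T ∈ adjMatrixSpace M ξ K₂ K₁ ∧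
      matTranspose hξ k₁ k₂ T ∈ adjMatrixSpace M ξ K₂ K₁ ∧
      matTranspose hξ k₂ k₁ (matTranspose hξ k₁ k₂ T) = T ∧
      dagM (dagM T) = T ∧
      matTranspose hξ k₂ k₁ (dagM T) = dagM (matTranspose hξ k₁ k₂ T) ∧
      ∀ c : K₁, ∃ h : onXi T (k₁ c) ∈ (conjTomita k₂ hξ).domain,
        onXi (matTranspose hξ k₂ k₁ (dagM T)) c = conjTomita k₂ hξ ⟨onXi T (k₁ c), h⟩) ∧
    (∀ C ∈ adjMatrixSpace M ξ ℂ K, ∃ h : valXi (asCol C) ∈ (conjTomita k hξ).domain,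
      valXi (asCol (matTranspose hξ k HilbertConj.complex (dagM C))) =
        conjTomita k hξ ⟨valXi (asCol C), h⟩) := by
  refine ⟨adjMatrixSpace_eq_ofMatrix hξ, adjMatrixSpace_eq hξ, HSTensorOp_subset hξ,
    HSTensorOp_eq_of_scalar hξ, HSTensorOp_complex hξ, fun A hA X hX => ?_, adjColSpace_eq hξ,
    adjRowSpace_eq hξ, adjColSpace_eq_ket k hξ, adjColSpace_eq_valXi k hξ,
    fun T hT => adjMatrixSpace_adjoint_transpose hξ k₁ k₂ hT, fun C hC => ?_⟩
  · rw [matTranspose_tensorOp hξ hA hX.2, dagM_tensorOp hξ _ hX]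
    refine ⟨rfl, ?_⟩
    rw [transposeOp, ContinuousLinearMap.adjoint_adjoint]
  · obtain ⟨h, h'⟩ :=
      (adjMatrixSpace_adjoint_transpose hξ HilbertConj.complex k hC).2.2.2.2.2 1
    -- A column is evaluated at `1 ∈ ℂ`, which conjugation fixes, so no conjugation is left in the
    -- formula.
    have h1 : HilbertConj.complex (1 : ℂ) = 1 := map_one (starRingEnd ℂ)
    simp only [h1] at h h'
    exact ⟨h, h'⟩
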